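/- Let $p\ge 0$ be an integer. For $z\in\mathbb C$ let $\sqrt z$ be the square root with $\arg\sqrt z\in[-\frac\pi2,\frac\pi2)$. Let $\mathcal S_p$ be the set of all collections $S=\{\lambda_n,\alpha_n\}_{n\ge1}$ of complex numbers such that $$\rho_n:=\sqrt{\lambda_n}=n-p-1+\varkappa_n,\qquad \alpha_n=\frac2\pi+\kappa_n,\qquad \{\varkappa_n\},\{\kappa_n\}\in l_2 .$$ Put $\tilde\lambda_n=0$ for $n\le p$, $\tilde\lambda_n=(n-p-1)^2$ for $n>p$; $\tilde\alpha_1=\frac1\pi$, $\tilde\alpha_n=0$ for $2\le n\le p+1$, $\tilde\alpha_n=\frac2\pi$ for $n>p+1$; $\tilde\rho_n=\sqrt{\tilde\lambda_n}$, $\hat\rho_n=\rho_n-\tilde\rho_n$; and write $\lambda_{n0}=\lambda_n$, $\lambda_{n1}=\tilde\lambda_n$, and similarly $\rho_{ni}$, $\alpha_{ni}$. Let $\tilde D(x,\lambda,\mu)=\int_0^x\cos(\sqrt\lambda\,t)\cos(\sqrt\mu\,t)\,dt$, and for $x\in[0,\pi]$ put $$\tilde Q_{ni,kj}(x)=\alpha_{kj}\tilde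 D(x,\lambda_{ni},\lambda_{kj}),\qquad \dot{\tilde Q}_{n0,kj}(x)=\frac{\partial}{\partial\rho}\,\alpha_{kj}\tilde D(x,\rho^2,\lambda_{kj})\Big|_{\rho=\rho_{n0}} .$$ Define the $2\times2$ blocks $\tilde H_{nk}(x)=(\tilde H_{ni,kj}(x))_{i,j=0,1}$, $n,k\ge1$, by $$\tilde H_{nk}(x)=\begin{pmatrix}\hat\rho_n^{-1}&-\hat\rho_n^{-1}\\0&1\end{pmatrix}\begin{pmatrix}\tilde Q_{n0,k0}(x)&-\tilde Q_{n0,k1}(x)\\\tilde Q_{n1,k0}(x)&-\tilde Q_{n1,k1}(x)\end{pmatrix}\begin{pmatrix}\hat\rho_k&1\\0&1\end{pmatrix}\quad(\hat\rho_n\ne0),$$ $$\tilde H_{nk}(x)=\begin{pmatrix}\dot{\tilde Q}_{n0,k0}(x)&-\dot{\tilde Q}_{n0,k1}(x)\\\tilde Q_{n1,k0}(x)&-\tilde Q_{n1,k1}(x)\end{pmatrix}\begin{pmatrix}\hat\rho_k&1\\0&1\end{pmatrix}\quad(\hat\rho_n=0).$$ Let $m$ be the Banach space of bounded complex sequences $a=(a_{ni})_{n\ge1,\,i=0,1}$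 with the norm $\sup|a_{ni}|$, and let $E$ be the identity operator. Finally, for $S\in\mathcal S_p$ let $$A(S)=\#\{n\ge1:\alpha_n=0\},\qquad B(S)=\sum_{k\in\mathcal I}(m_k-1),$$ where $m_k=\#\{n\ge1:\lambda_n=\lambda_k,\ \alpha_n\ne0\}$ and $\mathcal I=\{n\ge1:\alpha_n\ne0\text{ and }\lambda_n\ne\lambda_k\text{ for all }k<n\text{ with }\alpha_k\ne0\}$, so that every distinct value among the $\lambda_n$ with $\alpha_n\neq0$ is represented in $\mathcal I$ exactly once. (Both numbers are finite.) Theorem. Let $S\in\mathcal S_p$ and $A(S)+B(S)\ge p+1$. Then the infinite matrix $\tilde H(\pi)=(\tilde H_{nk}(\pi))_{n,k\ge1}$ defines, with absolutely convergent row sums, a bounded linear operator on $m$, and the operator $E+\tilde H(\pi)$ is not invertible on $m$. -/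

import Mathlib

open scoped ENNReal ComplexConjugate

noncomputable section

namespace PolySL

/-- The square root `ρ = √z` with `arg ρ ∈ [-π/2, π/2)`. (Mathlib's `z ^ (1/2)` has its argument
in `(-π/2, π/2]`; conjugating twice moves the cut to the required side.) -/
def root (z : ℂ) : ℂ := conj ((conj z) ^ (1 / 2 : ℂ))

theorem root_sq (z : ℂ) : root z ^ 2 = z := by
  unfold root
  rw [← map_pow, one_div, ← Nat.cast_ofNat, Complex.cpow_nat_inv_pow _ two_ne_zero]
  exact Complex.conj_conj z

theorem root_arg (z : ℂ) : (root z).arg ∈ Set.Ico (-(Real.pi / 2)) (Real.pi / 2) := by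
  have key : ∀ w : ℂ, (w ^ (1 / 2 : ℂ)).arg ∈ Set.Ioc (-(Real.pi / 2)) (Real.pi / 2) := by
    intro w
    rcases eq_or_ne w 0 with rfl | hw
    · have := Real.pi_pos
      simp
      constructor <;> linarith
    · have h1 := Complex.neg_pi_lt_arg w
      have h2 := Complex.arg_le_pi w
      have h3 : (w ^ (1 / 2 : ℂ)).arg = w.arg / 2 := by
        rw [Complex.cpow_def_of_ne_zero hw, Complex.arg_exp]
        have him : (Complex.log w * (1 / 2 : ℂ)).im = w.arg / 2 := by
          have : (1 / 2 : ℂ) = ((1 / 2 : ℝ) : ℂ) := by push_cast; rfl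
          rw [this, Complex.im_mul_ofReal, Complex.log_im]; ring
        rw [him]
        exact (toIocMod_eq_self _).2 ⟨by linarith, by linarith⟩
      rw [h3]
      constructor <;> linarith
  have hk := key (conj z)
  unfold root
  rw [Complex.arg_conj]
  have hpi := Real.pi_pos
  split_ifs with h
  · rw [h] at hk
    exact absurd hk.2 (by linarith)
  · exact ⟨by linarith [hk.2], by linarith [hk.1]⟩

/-- A collection `{λ_n, α_n}_{n ≥ 1}` of complex numbers. -/
structure SpectralData where
  /-- the eigenvalues `λ_n` -/
  lam : ℕ+ → ℂ
  /-- the weight numbers `α_n` -/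
  alpha : ℕ+ → ℂ

/-- `ρ_n = √λ_n`. -/
def SpectralData.rho (S : SpectralData) (n : ℕ+) : ℂ := root (S.lam n)

/-- The class `𝒮_p`: `ρ_n = n - p - 1 + ϰ_n` and `α_n = 2/π + κ_n` with `{ϰ_n}, {κ_n} ∈ l₂`. -/
def classS (p : ℕ) : Set SpectralData :=
  {S | Memℓp (fun n : ℕ+ => S.rho n - ((n : ℂ) - p - 1)) 2 ∧
       Memℓp (fun n : ℕ+ => S.alpha n - 2 / (Real.pi : ℂ)) 2}

/-- The spectral data `{λ̃_n, α̃_n}` of the model problem. -/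
def model (p : ℕ) : SpectralData where
  lam n := if (n : ℕ) ≤ p then 0 else ((n : ℂ) - p - 1) ^ 2
  alpha n := if n = 1 then 1 / (Real.pi : ℂ)
    else if (n : ℕ) ≤ p + 1 then 0 else 2 / (Real.pi : ℂ)

/-- `λ_{ni}`: `λ_{n0} = λ_n` and `λ_{n1} = λ̃_n`; likewise for `ρ_{ni}` and `α_{ni}`. -/
def data (p : ℕ) (S : SpectralData) (i : Fin 2) : SpectralData := if i = 0 then S else model p

/-- `φ̃(x, λ)`, the solution of `-y'' = λ y`, `y(0) = 1`, `y'(0) = 0`, i.e. `cos (√λ x)`. -/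
def phi (x : ℝ) (l : ℂ) : ℂ := Complex.cos (root l * x)

theorem phi_sq (x : ℝ) (r : ℂ) : phi x (r ^ 2) = Complex.cos (r * x) := by
  unfold phi
  rcases sq_eq_sq_iff_eq_or_eq_neg.1 (root_sq (r ^ 2)) with h | h <;> rw [h]
  rw [neg_mul, Complex.cos_neg]

/-- `φ̃(·, λ)` solves the initial value problem. -/
theorem phi_solves (l : ℂ) : phi 0 l = 1 ∧ ∃ y' : ℝ → ℂ, y' 0 = 0 ∧
    (∀ x, HasDerivAt (fun t => phi t l) (y' x) x) ∧
    ∀ x, HasDerivAt y' (-(l * phi x l)) x := by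
  have lin : ∀ z : ℂ, HasDerivAt (fun t : ℂ => root l * t) (root l) z := fun z => by
    simpa using (hasDerivAt_id z).const_mul (root l)
  refine ⟨by simp [phi], fun x => -Complex.sin (root l * x) * root l, by simp,
    fun x => (lin x).ccos.comp_ofReal, fun x => ?_⟩
  have h := (((lin x).csin.neg).mul_const (root l)).comp_ofReal
  refine h.congr_deriv ?_
  have hr := root_sq l
  unfold phi
  linear_combination (-Complex.cos (root l * x)) * hr

/-- `D̃(x, λ, μ) = ∫₀ˣ φ̃(t, λ) φ̃(t, μ) dt`. -/
def D (x : ℝ) (l m : ℂ) : ℂ := ∫ t in (0 : ℝ)..x, phi t l * phi t m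

/-- `Q̃(x, λ, λ_{kj}) = α_{kj} D̃(x, λ, λ_{kj})`. -/
def Qfun (p : ℕ) (S : SpectralData) (x : ℝ) (l : ℂ) (k : ℕ+) (j : Fin 2) : ℂ :=
  (data p S j).alpha k * D x l ((data p S j).lam k)

/-- `Q̃_{ni,kj}(x)`. -/
def Q (p : ℕ) (S : SpectralData) (x : ℝ) (n : ℕ+) (i : Fin 2) (k : ℕ+) (j : Fin 2) : ℂ :=
  Qfun p S x ((data p S i).lam n) k j

/-- The derivative of `Q̃(x, ρ², λ_{kj})` in `ρ` at `ρ = ρ_{n0}`. -/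
def Qdot (p : ℕ) (S : SpectralData) (x : ℝ) (n : ℕ+) (k : ℕ+) (j : Fin 2) : ℂ :=
  deriv (fun r : ℂ => Qfun p S x (r ^ 2) k j) ((data p S 0).rho n)

/-- `ρ̂_n = ρ_n - ρ̃_n`. -/
def rhoHat (p : ℕ) (S : SpectralData) (n : ℕ+) : ℂ := S.rho n - (model p).rho n

/-- The block `T_n` (used for `ρ̂_n ≠ 0`). -/
def T (p : ℕ) (S : SpectralData) (n : ℕ+) : Matrix (Fin 2) (Fin 2) ℂ :=
  !![(rhoHat p S n)⁻¹, -(rhoHat p S n)⁻¹; 0, 1]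

/-- The block denoted `T_n⁻¹`, which makes sense for every value of `ρ̂_n`. -/
def Tinv (p : ℕ) (S : SpectralData) (n : ℕ+) : Matrix (Fin 2) (Fin 2) ℂ :=
  !![rhoHat p S n, 1; 0, 1]

open Classical in
/-- The `2 × 2` block `H̃_{nk}(x)`; its `(i, j)` entry is `H̃_{ni,kj}(x)`. -/
def Hblock (p : ℕ) (S : SpectralData) (x : ℝ) (n k : ℕ+) : Matrix (Fin 2) (Fin 2) ℂ :=
  if rhoHat p S n ≠ 0 then
    T p S n *
      !![Q p S x n 0 k 0, -Q p S x n 0 k 1;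
         Q p S x n 1 k 0, -Q p S x n 1 k 1] * Tinv p S k
  else
    !![Qdot p S x n k 0, -Qdot p S x n k 1;
       Q p S x n 1 k 0, -Q p S x n 1 k 1] * Tinv p S k

/-- The Banach space `m` of bounded sequences `(a_{ni})_{n ≥ 1, i = 0, 1}` with the sup norm. -/
abbrev m : Type := lp (fun _ : ℕ+ × Fin 2 => ℂ) ∞

/-- `H` is the bounded operator on `m` given by the infinite matrix `H̃(x)`, all the row series
being absolutely convergent. There is at most one such `H`. -/
def IsHOperator (p : ℕ) (S : SpectralData) (x : ℝ) (H : m →L[ℂ] m) : Prop :=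
  ∀ (f : m) (n : ℕ+) (i : Fin 2),
    HasSum (fun kj : ℕ+ × Fin 2 => Hblock p S x n kj.1 i kj.2 * f kj) (H f (n, i))

/-- `A(S)`, the number of zero weight numbers. -/
def A (S : SpectralData) : ℕ := {n : ℕ+ | S.alpha n = 0}.ncard

/-- The index set of the distinct eigenvalues carrying a non-zero weight number: each such
eigenvalue is represented by its first index with a non-zero weight number. -/
def I (S : SpectralData) : Set ℕ+ :=
  {n | (∀ k < n, S.alpha k ≠ 0 → S.lam n ≠ S.lam k) ∧ S.alpha n ≠ 0}

/-- `m_k(S)`, the multiplicity of `λ_k`, counted over non-zero weight numbers. -/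
def mult (S : SpectralData) (k : ℕ+) : ℕ := {n : ℕ+ | S.lam n = S.lam k ∧ S.alpha n ≠ 0}.ncard

/-- `B(S) = ∑_{k ∈ I} (m_k - 1)`. -/
def B (S : SpectralData) : ℕ := ∑ᶠ k ∈ I S, (mult S k - 1)

theorem finite_of_memlp {f : ℕ+ → ℂ} (hf : Memℓp f 2) {e : ℝ} (he : 0 < e) :
    {n | e ≤ ‖f n‖}.Finite := by
  have h1 : Summable fun n => ‖f n‖ ^ (2 : ℝ≥0∞).toReal := hf.summable (by norm_num)
  have h2 := h1.tendsto_cofinite_zero.eventually (gt_mem_nhds (show (0 : ℝ) < e ^ 2 by positivity))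
  refine (Filter.eventually_cofinite.1 h2).subset fun n hn => ?_
  simp only [Set.mem_ofPred_eq, not_lt, ENNReal.toReal_ofNat, Real.rpow_ofNat] at hn ⊢
  gcongr

/-- `A(S)` counts a finite set. -/
theorem A_finite {p : ℕ} {S : SpectralData} (hS : S ∈ classS p) :
    {n : ℕ+ | S.alpha n = 0}.Finite := by
  have hpi := Real.pi_pos
  refine (finite_of_memlp hS.2 (e := 2 / Real.pi) (by positivity)).subset fun n hn => ?_
  have hn' : S.alpha n = 0 := hn
  simp [hn', abs_of_pos hpi]

/-- All but finitely many `λ_k` are different from all the other ones. -/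
theorem repeated_finite {p : ℕ} {S : SpectralData} (hS : S ∈ classS p) :
    {k : ℕ+ | ∃ n, n ≠ k ∧ S.lam n = S.lam k}.Finite := by
  set f : ℕ+ → ℂ := fun n => S.rho n - ((n : ℂ) - p - 1) with hf
  have hF := finite_of_memlp hS.1 (e := 1 / 4) (by norm_num)
  have hN : ∀ R : ℝ, {k : ℕ+ | (k : ℝ) ≤ R}.Finite := fun R =>
    ((Set.finite_Iic ⌊R⌋₊).preimage PNat.coe_injective.injOn).subset
      fun k hk => Nat.le_floor hk
  refine (hF.union (hF.biUnion fun n _ => hN (n + ‖f n‖ + 1 / 4))).subset ?_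
  rintro k ⟨n, hnk, hl⟩
  by_cases hk : 1 / 4 ≤ ‖f k‖
  · exact Or.inl hk
  have hrho : S.rho n = S.rho k := by unfold SpectralData.rho; rw [hl]
  have hdiff : (((k : ℝ) - (n : ℝ) : ℝ) : ℂ) = f n - f k := by
    simp only [hf, hrho]; push_cast; ring
  have hle : |(k : ℝ) - (n : ℝ)| ≤ ‖f n‖ + ‖f k‖ := by
    rw [← Real.norm_eq_abs, ← Complex.norm_real, hdiff]
    exact norm_sub_le _ _
  push Not at hk
  have hn : 1 / 4 ≤ ‖f n‖ := by
    by_contra hn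
    push Not at hn
    have h1 : |(k : ℝ) - (n : ℝ)| < 1 := by linarith
    have h2 : |((k : ℕ) : ℤ) - ((n : ℕ) : ℤ)| < 1 := by exact_mod_cast h1
    rw [Int.abs_lt_one_iff] at h2
    exact hnk (PNat.coe_injective (by omega))
  refine Or.inr (Set.mem_biUnion hn ?_)
  have := le_abs_self ((k : ℝ) - (n : ℝ))
  simp only [Set.mem_ofPred_eq]
  linarith

/-- The multiplicities are finite. -/
theorem mult_finite {p : ℕ} {S : SpectralData} (hS : S ∈ classS p) (k : ℕ+) :
    {n : ℕ+ | S.lam n = S.lam k ∧ S.alpha n ≠ 0}.Finite := by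
  refine ((repeated_finite hS).insert k).subset fun n hn => ?_
  by_cases h : n = k
  · exact Or.inl h
  · exact Or.inr ⟨k, fun e => h e.symm, hn.1.symm⟩

/-- The sum `B(S)` has finitely many non-zero terms. -/
theorem B_finite {p : ℕ} {S : SpectralData} (hS : S ∈ classS p) :
    {k : ℕ+ | mult S k - 1 ≠ 0}.Finite := by
  refine (repeated_finite hS).subset fun k hk => ?_
  have h1 : 1 < mult S k := by have : mult S k - 1 ≠ 0 := hk; omega
  obtain ⟨n, hn, hne⟩ := Set.exists_ne_of_one_lt_ncard h1 k
  exact ⟨n, hne, hn.1⟩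

/-- Representing an eigenvalue by its first index among all indices, and omitting it when the
weight number there vanishes, gives a sum that is at most `B(S)`. -/
theorem sum_first_index_le_B {p : ℕ} {S : SpectralData} (hS : S ∈ classS p) :
    ∑ᶠ k ∈ {n : ℕ+ | (n = 1 ∨ ∀ k < n, S.lam n ≠ S.lam k) ∧ S.alpha n ≠ 0}, (mult S k - 1)
      ≤ B S := by
  classical
  have hsub : {n : ℕ+ | (n = 1 ∨ ∀ k < n, S.lam n ≠ S.lam k) ∧ S.alpha n ≠ 0} ⊆ I S := by
    rintro n ⟨h | h, ha⟩
    · exact ⟨fun k hk => absurd hk (by rw [h]; exact not_lt_one), ha⟩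
    · exact ⟨fun k hk _ => h k hk, ha⟩
  unfold B
  have hsupp : ∀ J : Set ℕ+, Function.support
      (fun k => ∑ᶠ _ : k ∈ J, (mult S k - 1)) ⊆ (B_finite hS).toFinset := by
    intro J k hk
    simp only [Set.Finite.coe_toFinset, Set.mem_ofPred_eq]
    intro h0
    exact hk (by simp [h0])
  rw [finsum_eq_sum_of_support_subset _ (hsupp _), finsum_eq_sum_of_support_subset _ (hsupp _)]
  refine Finset.sum_le_sum fun k _ => ?_
  by_cases hk : k ∈ {n : ℕ+ | (n = 1 ∨ ∀ k < n, S.lam n ≠ S.lam k) ∧ S.alpha n ≠ 0}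
  · rw [finsum_eq_if, finsum_eq_if, if_pos hk, if_pos (hsub hk)]
  · rw [finsum_eq_if, if_neg hk]
    exact Nat.zero_le _

end PolySL

end

noncomputable section

namespace PolySL

open Real intervalIntegral

/-! ### Elementary estimates -/

/-! The matrix factors through functions on `[0, π]`: its entries are `∫ u_{ni} v_{kj}`. Here
`u_{n1} = cos ρ̃_n t`, and `u_{n0}` is the divided difference of `cos ρt` between `ρ̃_n` and `ρ_n`
(the `ρ`-derivative when they coincide). The columns are `v_{k0} = α_k ρ̂_k cos ρ_k t` and `v_{k1} =
α_k cos ρ_k t - α̃_k cos ρ̃_k t` (`Hblock_eq_pair`).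

Boundedness on `m`: the `u_{ni}` are uniformly bounded. A pairing with `v_{kj}` is dominated by
products of two square-summable quantities, taken from `ρ̂_k`, `α_k - α̃_k` and the Fourier
coefficients of `u` and `t u`. Bessel's inequality then bounds the row sums uniformly
(`exists_row_sums_le`).

Non-invertibility: suppose `f = ∑ c_j cos jt` is non-zero in `L₂` and orthogonal, for the bilinear
pairing, to every `cos ρ_k t` with `α_k ≠ 0`. Put `a_{ni} = ∫ f u_{ni}`. Since `ρ̂_k a_{k0} + a_{k1}
= ∫ f cos ρ_k t`, all terms of `H̃(π) a` containing `α_k` cancel. What remains is `-∑ α̃_k ∫ u_{ni}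
cos ρ̃_k t · ∫ f cos ρ̃_k t`, which is `-a_{ni}` by Parseval for the cosine basis. Hence `a` lies in
the kernel of `E + H̃(π)`, and `a ≠ 0` because the `a_{n1}` contain all cosine coefficients of `f`
(`exists_mem_ker`).

Such an `f` exists by counting (`exists_ne_zero_seriesPair_cosRho`). Zero weights and repetitions
remove `A + B ≥ p + 1` functions from the first `p + N`, leaving fewer than `N`. The remaining tail
is quadratically close to `cos jt`, `j ≥ N`, so by a Neumann series orthogonality to the tail leaves
an `N`-dimensional space, in which fewer than `N` further conditions have a common non-zero
solution. -/

theorem norm_exp_sub_one_le (z : ℂ) : ‖Complex.exp z - 1‖ ≤ ‖z‖ * exp ‖z‖ := by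
  simpa using Complex.norm_exp_sub_sum_le_norm_mul_exp z 1

theorem norm_exp_sub_one_sub_le (z : ℂ) : ‖Complex.exp z - 1 - z‖ ≤ ‖z‖ ^ 2 * exp ‖z‖ := by
  have := Complex.norm_exp_sub_sum_le_norm_mul_exp z 2
  simpa [Finset.sum_range_succ, sub_sub] using this

theorem norm_sin_le (z : ℂ) : ‖Complex.sin z‖ ≤ ‖z‖ * exp ‖z‖ := by
  have h : Complex.sin z = ((Complex.exp (-z * Complex.I) - 1) -
      (Complex.exp (z * Complex.I) - 1)) * Complex.I / 2 := by
    rw [Complex.sin]; ring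
  have h1 := norm_exp_sub_one_le (-z * Complex.I)
  have h2 := norm_exp_sub_one_le (z * Complex.I)
  simp only [norm_mul, norm_neg, Complex.norm_I, mul_one] at h1 h2
  rw [h, norm_div, norm_mul, Complex.norm_I, Complex.norm_ofNat, mul_one]
  have := norm_sub_le (Complex.exp (-z * Complex.I) - 1) (Complex.exp (z * Complex.I) - 1)
  linarith

theorem norm_cos_sub_one_le (z : ℂ) : ‖Complex.cos z - 1‖ ≤ ‖z‖ ^ 2 * exp ‖z‖ := by
  have h : Complex.cos z - 1 = ((Complex.exp (z * Complex.I) - 1 - z * Complex.I) +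
      (Complex.exp (-z * Complex.I) - 1 - -z * Complex.I)) / 2 := by
    rw [Complex.cos]; ring
  have h1 := norm_exp_sub_one_sub_le (-z * Complex.I)
  have h2 := norm_exp_sub_one_sub_le (z * Complex.I)
  simp only [norm_mul, norm_neg, Complex.norm_I, mul_one] at h1 h2
  rw [h, norm_div, Complex.norm_ofNat]
  have := norm_add_le (Complex.exp (z * Complex.I) - 1 - z * Complex.I)
    (Complex.exp (-z * Complex.I) - 1 - -z * Complex.I)
  linarith

theorem norm_sin_sub_le (z : ℂ) : ‖Complex.sin z - z‖ ≤ ‖z‖ ^ 2 * exp ‖z‖ := by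
  have h : Complex.sin z - z = ((Complex.exp (-z * Complex.I) - 1 - -z * Complex.I) -
      (Complex.exp (z * Complex.I) - 1 - z * Complex.I)) * Complex.I / 2 := by
    rw [Complex.sin]
    linear_combination (-z) * Complex.I_sq
  have h1 := norm_exp_sub_one_sub_le (-z * Complex.I)
  have h2 := norm_exp_sub_one_sub_le (z * Complex.I)
  simp only [norm_mul, norm_neg, Complex.norm_I, mul_one] at h1 h2
  rw [h, norm_div, norm_mul, Complex.norm_I, Complex.norm_ofNat, mul_one]
  have := norm_sub_le (Complex.exp (-z * Complex.I) - 1 - -z * Complex.I)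
    (Complex.exp (z * Complex.I) - 1 - z * Complex.I)
  linarith

theorem norm_ofReal_cos_le (x : ℝ) : ‖Complex.cos x‖ ≤ 1 := by
  rw [← Complex.ofReal_cos, Complex.norm_real]; exact Real.abs_cos_le_one x

theorem norm_ofReal_sin_le (x : ℝ) : ‖Complex.sin x‖ ≤ 1 := by
  rw [← Complex.ofReal_sin, Complex.norm_real]; exact Real.abs_sin_le_one x

/-- A constant that dominates all the elementary bounds on `cos` near the real axis. -/
def trigConst (R : ℝ) : ℝ := (π + 2 * π ^ 2 * (1 + R)) * exp (R * π)

theorem trigConst_nonneg {R : ℝ} (hR : 0 ≤ R) : 0 ≤ trigConst R := by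
  unfold trigConst; positivity

/-- The addition formula isolates factors with the real argument `b t`, bounded by 1, so the
constant does not depend on `b`. This uniformity is needed along the whole sequence `ρ_n`. -/
theorem norm_cos_sub_cos_le {R : ℝ} (b : ℝ) {h : ℂ} (hh : ‖h‖ ≤ R) {t : ℝ}
    (ht : t ∈ Set.Icc 0 π) :
    ‖Complex.cos ((b + h) * t) - Complex.cos (b * t)‖ ≤ trigConst R * ‖h‖ := by
  have hR : 0 ≤ R := (norm_nonneg h).trans hh
  have hz : ‖h * t‖ ≤ ‖h‖ * π := by
    rw [norm_mul, Complex.norm_real, norm_of_nonneg ht.1]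
    exact mul_le_mul_of_nonneg_left ht.2 (norm_nonneg _)
  have hz2 : ‖h * t‖ ≤ R * π := hz.trans (by gcongr)
  have key : Complex.cos ((b + h) * t) - Complex.cos (b * t) =
      Complex.cos ((b * t : ℝ) : ℂ) * (Complex.cos (h * t) - 1)
        - Complex.sin ((b * t : ℝ) : ℂ) * Complex.sin (h * t) := by
    rw [add_mul, Complex.cos_add]; push_cast; ring
  have h1 := norm_cos_sub_one_le (h * t)
  have h2 := norm_sin_le (h * t)
  rw [key]
  calc _ ≤ 1 * (‖h * t‖ ^ 2 * exp ‖h * t‖) + 1 * (‖h * t‖ * exp ‖h * t‖) := by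
        refine (norm_sub_le _ _).trans ?_
        rw [norm_mul, norm_mul]
        gcongr
        · exact norm_ofReal_cos_le _
        · exact norm_ofReal_sin_le _
    _ ≤ 1 * (((‖h‖ * π) * (R * π)) * exp (R * π)) + 1 * ((‖h‖ * π) * exp (R * π)) := by
        rw [sq]; gcongr
    _ ≤ trigConst R * ‖h‖ := by
        unfold trigConst
        have := exp_pos (R * π)
        have hp : 0 ≤ ‖h‖ * π ^ 2 * exp (R * π) * (2 + R) := by positivity
        nlinarith

/-- The first-order term is kept explicit: its size `‖h‖` is only square-summable along the
sequence, and it becomes summable once paired with a sine system under Bessel's inequality. -/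
theorem norm_cos_sub_cos_add_le {R : ℝ} (b : ℝ) {h : ℂ} (hh : ‖h‖ ≤ R) {t : ℝ}
    (ht : t ∈ Set.Icc 0 π) :
    ‖Complex.cos ((b + h) * t) - Complex.cos (b * t) + h * (t * Complex.sin (b * t))‖
      ≤ trigConst R * ‖h‖ ^ 2 := by
  have hR : 0 ≤ R := (norm_nonneg h).trans hh
  have hz : ‖h * t‖ ≤ ‖h‖ * π := by
    rw [norm_mul, Complex.norm_real, norm_of_nonneg ht.1]
    exact mul_le_mul_of_nonneg_left ht.2 (norm_nonneg _)
  have hz2 : ‖h * t‖ ≤ R * π := hz.trans (by gcongr)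
  have key : Complex.cos ((b + h) * t) - Complex.cos (b * t) + h * (t * Complex.sin (b * t)) =
      Complex.cos ((b * t : ℝ) : ℂ) * (Complex.cos (h * t) - 1)
        - Complex.sin ((b * t : ℝ) : ℂ) * (Complex.sin (h * t) - h * t) := by
    rw [add_mul, Complex.cos_add]; push_cast; ring
  have h1 := norm_cos_sub_one_le (h * t)
  have h2 := norm_sin_sub_le (h * t)
  rw [key]
  calc _ ≤ 1 * (‖h * t‖ ^ 2 * exp ‖h * t‖) + 1 * (‖h * t‖ ^ 2 * exp ‖h * t‖) := by
        refine (norm_sub_le _ _).trans ?_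
        rw [norm_mul, norm_mul]
        gcongr
        · exact norm_ofReal_cos_le _
        · exact norm_ofReal_sin_le _
    _ ≤ 1 * ((‖h‖ * π) ^ 2 * exp (R * π)) + 1 * ((‖h‖ * π) ^ 2 * exp (R * π)) := by
        gcongr
    _ ≤ trigConst R * ‖h‖ ^ 2 := by
        unfold trigConst
        have := exp_pos (R * π)
        have hp : 0 ≤ ‖h‖ ^ 2 * exp (R * π) * (π + 2 * π ^ 2 * R) := by positivity
        nlinarith

/-- The other candidate `-j` with `j > 0` has argument `π`, outside the range of the chosen branch.
-/
theorem root_natCast_sq (j : ℕ) : root ((j : ℂ) ^ 2) = j := by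
  rcases sq_eq_sq_iff_eq_or_eq_neg.1 (root_sq ((j : ℂ) ^ 2)) with h | h
  · exact h
  · rcases Nat.eq_zero_or_pos j with rfl | hj
    · simpa using h
    · have harg := (root_arg ((j : ℂ) ^ 2)).2
      have : (-(j : ℂ)).arg = π := by
        rw [Complex.arg_eq_pi_iff]; simp [hj]
      rw [h, this] at harg
      linarith [pi_pos]

/-! ### The bilinear pairing on `[0, π]` -/

/-- The pairing `∫₀^π u v`. -/
def pair (u v : ℝ → ℂ) : ℂ := ∫ t in (0 : ℝ)..π, u t * v t

theorem pair_comm (u v : ℝ → ℂ) : pair u v = pair v u := by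
  simp only [pair, mul_comm]

theorem pair_add_left {u v w : ℝ → ℂ} (hu : Continuous u) (hv : Continuous v)
    (hw : Continuous w) : pair (fun t => u t + v t) w = pair u w + pair v w := by
  simp only [pair, add_mul]
  exact integral_add ((hu.mul hw).intervalIntegrable _ _) ((hv.mul hw).intervalIntegrable _ _)

theorem pair_sub_left {u v w : ℝ → ℂ} (hu : Continuous u) (hv : Continuous v)
    (hw : Continuous w) : pair (fun t => u t - v t) w = pair u w - pair v w := by
  simp only [pair, sub_mul]
  exact integral_sub ((hu.mul hw).intervalIntegrable _ _) ((hv.mul hw).intervalIntegrable _ _)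

theorem pair_smul_left (a : ℂ) (u v : ℝ → ℂ) : pair (fun t => a * u t) v = a * pair u v := by
  simp only [pair, mul_assoc, integral_const_mul]

theorem norm_pair_le {u v : ℝ → ℂ} {M N : ℝ} (hu : ∀ t ∈ Set.Icc 0 π, ‖u t‖ ≤ M)
    (hv : ∀ t ∈ Set.Icc 0 π, ‖v t‖ ≤ N) : ‖pair u v‖ ≤ π * (M * N) := by
  have := norm_integral_le_of_norm_le_const (a := 0) (b := π) (f := fun t => u t * v t)
    (C := M * N) (fun t ht => by
      rw [Set.uIoc_of_le pi_pos.le] at ht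
      have ht' : t ∈ Set.Icc 0 π := ⟨ht.1.le, ht.2⟩
      rw [norm_mul]
      exact mul_le_mul (hu t ht') (hv t ht') (norm_nonneg _) ((norm_nonneg _).trans (hu t ht')))
  rw [sub_zero, abs_of_pos pi_pos, mul_comm] at this
  exact this

/-! ### Bessel's inequality -/

/-- Only the bound `∫ e_i² ≤ π` is required, so no normalization is needed and the exceptional index
0 (squared norm `π` for the cosine, 0 for the sine) needs no separate treatment. -/
theorem bessel_real {e : ℕ → ℝ → ℝ} (he : ∀ i, Continuous (e i))
    (horth : ∀ i j, i ≠ j → ∫ t in (0 : ℝ)..π, e i t * e j t = 0)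
    (hnorm : ∀ i, ∫ t in (0 : ℝ)..π, e i t * e i t ≤ π) {u : ℝ → ℝ} (hu : Continuous u)
    (s : Finset ℕ) :
    ∑ i ∈ s, (∫ t in (0 : ℝ)..π, u t * e i t) ^ 2 ≤ π * ∫ t in (0 : ℝ)..π, u t ^ 2 := by
  set c : ℕ → ℝ := fun i => ∫ t in (0 : ℝ)..π, u t * e i t with hc
  set w : ℝ → ℝ := fun t => ∑ i ∈ s, c i * e i t with hw
  have hwc : Continuous w := continuous_finsetSum _ fun i _ => continuous_const.mul (he i)
  have huw : ∫ t in (0 : ℝ)..π, u t * w t = ∑ i ∈ s, c i ^ 2 := by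
    simp only [hw, Finset.mul_sum]
    rw [integral_finsetSum (fun i _ => Continuous.intervalIntegrable (by fun_prop) _ _)]
    refine Finset.sum_congr rfl fun i _ => ?_
    rw [sq, hc, ← integral_const_mul]
    congr 1; ext t; ring
  have hew : ∀ i ∈ s, ∫ t in (0 : ℝ)..π, e i t * w t
      = c i * ∫ t in (0 : ℝ)..π, e i t * e i t := by
    intro i hi
    simp only [hw, Finset.mul_sum]
    rw [integral_finsetSum (fun i _ => Continuous.intervalIntegrable (by fun_prop) _ _),
      Finset.sum_eq_single i, ← integral_const_mul]
    · congr 1; ext t; ring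
    · intro j _ hj
      have : ∀ t, e i t * (c j * e j t) = c j * (e i t * e j t) := fun t => by ring
      simp only [this, integral_const_mul, horth i j hj.symm, mul_zero]
    · exact fun h => absurd hi h
  have hww : ∫ t in (0 : ℝ)..π, w t * w t ≤ π * ∑ i ∈ s, c i ^ 2 := by
    have h1 : ∀ t, w t * w t = ∑ i ∈ s, c i * (e i t * w t) := fun t => by
      simp only [← mul_assoc, ← Finset.sum_mul]; rfl
    simp only [h1]
    rw [integral_finsetSum (fun i _ => Continuous.intervalIntegrable (by fun_prop) _ _),
      Finset.mul_sum]
    refine Finset.sum_le_sum fun i hi => ?_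
    rw [integral_const_mul, hew i hi]
    nlinarith [hnorm i, sq_nonneg (c i)]
  -- With `w = ∑ c_i e_i`, the factor `π` matches `∫ w² ≤ π ∑ c_i²`: the cross term `-2π ∑ c_i²`
  -- then outweighs it by `π ∑ c_i²`.
  have hpos : 0 ≤ ∫ t in (0 : ℝ)..π, (π * u t - w t) ^ 2 :=
    integral_nonneg pi_pos.le fun t _ => sq_nonneg _
  have hexp : ∫ t in (0 : ℝ)..π, (π * u t - w t) ^ 2 =
      π ^ 2 * (∫ t in (0 : ℝ)..π, u t ^ 2) - 2 * π * (∫ t in (0 : ℝ)..π, u t * w t)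
        + ∫ t in (0 : ℝ)..π, w t * w t := by
    rw [← integral_const_mul, ← integral_const_mul, ← integral_sub, ← integral_add]
    · congr 1; ext t; ring
    all_goals exact Continuous.intervalIntegrable (by fun_prop) _ _
  rw [hexp, huw] at hpos
  have h2 : π * ∑ i ∈ s, c i ^ 2 ≤ π * (π * ∫ t in (0 : ℝ)..π, u t ^ 2) := by nlinarith
  exact le_of_mul_le_mul_left h2 pi_pos

theorem bessel {e : ℕ → ℝ → ℝ} (he : ∀ i, Continuous (e i))
    (horth : ∀ i j, i ≠ j → ∫ t in (0 : ℝ)..π, e i t * e j t = 0)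
    (hnorm : ∀ i, ∫ t in (0 : ℝ)..π, e i t * e i t ≤ π) {u : ℝ → ℂ} (hu : Continuous u)
    {M : ℝ} (hM : ∀ t ∈ Set.Icc 0 π, ‖u t‖ ≤ M) (s : Finset ℕ) :
    ∑ i ∈ s, ‖pair u (fun t => e i t)‖ ^ 2 ≤ (π * M) ^ 2 := by
  have hre : Continuous fun t => (u t).re := Complex.continuous_re.comp hu
  have him : Continuous fun t => (u t).im := Complex.continuous_im.comp hu
  have hsplit : ∀ i, ‖pair u (fun t => e i t)‖ ^ 2 =
      (∫ t in (0 : ℝ)..π, (u t).re * e i t) ^ 2 + (∫ t in (0 : ℝ)..π, (u t).im * e i t) ^ 2 := by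
    intro i
    have hint : IntervalIntegrable (fun t => u t * (e i t : ℂ)) MeasureTheory.volume 0 π :=
      (hu.mul (Complex.continuous_ofReal.comp (he i))).intervalIntegrable _ _
    have h1 := Complex.reCLM.intervalIntegral_comp_comm hint
    have h2 := Complex.imCLM.intervalIntegral_comp_comm hint
    simp only [Complex.reCLM_apply, Complex.imCLM_apply, Complex.re_mul_ofReal,
      Complex.im_mul_ofReal] at h1 h2
    rw [h1, h2, Complex.sq_norm, Complex.normSq_apply, pair]
    ring
  simp only [hsplit, Finset.sum_add_distrib]
  have h1 := bessel_real he horth hnorm hre s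
  have h2 := bessel_real he horth hnorm him s
  have h3 : (∫ t in (0 : ℝ)..π, (u t).re ^ 2) + (∫ t in (0 : ℝ)..π, (u t).im ^ 2)
      ≤ π * M ^ 2 := by
    rw [← integral_add (Continuous.intervalIntegrable (by fun_prop) _ _)
      (Continuous.intervalIntegrable (by fun_prop) _ _)]
    have : ∫ _ in (0 : ℝ)..π, M ^ 2 = π * M ^ 2 := by simp
    rw [← this]
    refine integral_mono_on pi_pos.le (Continuous.intervalIntegrable (by fun_prop) _ _)
      (Continuous.intervalIntegrable (by fun_prop) _ _) fun t ht => ?_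
    have h4 : (u t).re ^ 2 + (u t).im ^ 2 = ‖u t‖ ^ 2 := by
      rw [Complex.sq_norm, Complex.normSq_apply]; ring
    rw [h4]
    have := hM t ht
    gcongr
  nlinarith [pi_pos]

/-! ### The trigonometric systems -/

theorem integral_cos_int_mul {k : ℤ} (hk : k ≠ 0) : ∫ t in (0 : ℝ)..π, Real.cos (k * t) = 0 := by
  have hk' : (k : ℝ) ≠ 0 := by exact_mod_cast hk
  rw [intervalIntegral.integral_comp_mul_left _ hk', integral_cos]
  simp [Real.sin_int_mul_pi]

theorem integral_cos_mul_cos_eq (i j : ℕ) : ∫ t in (0 : ℝ)..π, Real.cos (i * t) * Real.cos (j * t)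
    = 2⁻¹ * ((∫ t in (0 : ℝ)..π, Real.cos (((i + j : ℤ) : ℝ) * t)) +
      ∫ t in (0 : ℝ)..π, Real.cos (((i - j : ℤ) : ℝ) * t)) := by
  rw [← integral_add (Continuous.intervalIntegrable (by fun_prop) _ _)
    (Continuous.intervalIntegrable (by fun_prop) _ _), ← integral_const_mul]
  congr 1; ext t
  push_cast
  rw [add_mul, sub_mul, Real.cos_add, Real.cos_sub]; ring

theorem integral_sin_mul_sin_eq (i j : ℕ) : ∫ t in (0 : ℝ)..π, Real.sin (i * t) * Real.sin (j * t)
    = 2⁻¹ * ((∫ t in (0 : ℝ)..π, Real.cos (((i - j : ℤ) : ℝ) * t)) -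
      ∫ t in (0 : ℝ)..π, Real.cos (((i + j : ℤ) : ℝ) * t)) := by
  rw [← integral_sub (Continuous.intervalIntegrable (by fun_prop) _ _)
    (Continuous.intervalIntegrable (by fun_prop) _ _), ← integral_const_mul]
  congr 1; ext t
  push_cast
  rw [add_mul, sub_mul, Real.cos_add, Real.cos_sub]; ring

theorem integral_cos_mul_cos_of_ne {i j : ℕ} (h : i ≠ j) :
    ∫ t in (0 : ℝ)..π, Real.cos (i * t) * Real.cos (j * t) = 0 := by
  rw [integral_cos_mul_cos_eq, integral_cos_int_mul (by omega), integral_cos_int_mul (by omega)]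
  simp

theorem integral_sin_mul_sin_of_ne {i j : ℕ} (h : i ≠ j) :
    ∫ t in (0 : ℝ)..π, Real.sin (i * t) * Real.sin (j * t) = 0 := by
  rw [integral_sin_mul_sin_eq, integral_cos_int_mul (by omega), integral_cos_int_mul (by omega)]
  simp

theorem integral_cos_mul_cos_self {j : ℕ} (h : j ≠ 0) :
    ∫ t in (0 : ℝ)..π, Real.cos (j * t) * Real.cos (j * t) = π / 2 := by
  rw [integral_cos_mul_cos_eq, integral_cos_int_mul (by omega)]
  simp; ring

theorem integral_le_pi_of_le_one {f : ℝ → ℝ} (hf : Continuous f) (h : ∀ t, f t ≤ 1) :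
    ∫ t in (0 : ℝ)..π, f t ≤ π := by
  have : ∫ _ in (0 : ℝ)..π, (1 : ℝ) = π := by simp
  conv_rhs => rw [← this]
  exact integral_mono_on pi_pos.le (hf.intervalIntegrable _ _)
    (Continuous.intervalIntegrable (by fun_prop) _ _) fun t _ => h t

/-- `cos (j t)`. -/
def cosN (j : ℕ) (t : ℝ) : ℂ := Complex.cos ((j : ℂ) * t)

/-- `sin (j t)`. -/
def sinN (j : ℕ) (t : ℝ) : ℂ := Complex.sin ((j : ℂ) * t)

theorem cosN_eq (j : ℕ) : cosN j = fun t => ((Real.cos (j * t) : ℝ) : ℂ) := by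
  ext t; simp [cosN]

theorem sinN_eq (j : ℕ) : sinN j = fun t => ((Real.sin (j * t) : ℝ) : ℂ) := by
  ext t; simp [sinN]

theorem continuous_cosN (j : ℕ) : Continuous (cosN j) := by unfold cosN; fun_prop

theorem continuous_sinN (j : ℕ) : Continuous (sinN j) := by unfold sinN; fun_prop

theorem bessel_cos {u : ℝ → ℂ} (hu : Continuous u) {M : ℝ}
    (hM : ∀ t ∈ Set.Icc 0 π, ‖u t‖ ≤ M) (s : Finset ℕ) :
    ∑ j ∈ s, ‖pair u (cosN j)‖ ^ 2 ≤ (π * M) ^ 2 := by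
  simp only [cosN_eq]
  refine bessel (e := fun j t => Real.cos (j * t)) (fun j => by fun_prop)
    (fun i j h => integral_cos_mul_cos_of_ne h) (fun j => ?_) hu hM s
  refine integral_le_pi_of_le_one (by fun_prop) fun t => ?_
  nlinarith [Real.sin_sq_add_cos_sq (j * t), sq_nonneg (Real.sin (j * t))]

theorem bessel_sin {u : ℝ → ℂ} (hu : Continuous u) {M : ℝ}
    (hM : ∀ t ∈ Set.Icc 0 π, ‖u t‖ ≤ M) (s : Finset ℕ) :
    ∑ j ∈ s, ‖pair u (sinN j)‖ ^ 2 ≤ (π * M) ^ 2 := by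
  simp only [sinN_eq]
  refine bessel (e := fun j t => Real.sin (j * t)) (fun j => by fun_prop)
    (fun i j h => integral_sin_mul_sin_of_ne h) (fun j => ?_) hu hM s
  refine integral_le_pi_of_le_one (by fun_prop) fun t => ?_
  nlinarith [Real.sin_sq_add_cos_sq (j * t), sq_nonneg (Real.cos (j * t))]

theorem pair_cosN_cosN (i j : ℕ) : pair (cosN i) (cosN j) =
    if i = j then if j = 0 then (π : ℂ) else (π : ℂ) / 2 else 0 := by
  have h : pair (cosN i) (cosN j) =
      ((∫ t in (0 : ℝ)..π, Real.cos (i * t) * Real.cos (j * t) : ℝ) : ℂ) := by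
    rw [← intervalIntegral.integral_ofReal]
    simp only [pair, cosN_eq, Complex.ofReal_mul]
  rw [h]
  split_ifs with h1 h2
  · subst h1 h2; simp
  · subst h1; rw [integral_cos_mul_cos_self h2]; simp
  · rw [integral_cos_mul_cos_of_ne h1]; simp

/-! ### Differentiation in the spectral parameter -/

/-- Differentiation under the integral sign; on the unit ball about `r` the derivative is dominated
through `‖z‖ ≤ ‖r‖ + 1`. -/
theorem hasDerivAt_pair_cos {v : ℝ → ℂ} (hv : Continuous v) (r : ℂ) :
    HasDerivAt (fun z : ℂ => pair (fun t => Complex.cos (z * t)) v)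
      (pair (fun t => -(t * Complex.sin (r * t))) v) r := by
  refine (intervalIntegral.hasDerivAt_integral_of_dominated_loc_of_deriv_le (𝕜 := ℂ)
    (F := fun (z : ℂ) (t : ℝ) => Complex.cos (z * t) * v t)
    (F' := fun (z : ℂ) (t : ℝ) => -(t * Complex.sin (z * t)) * v t)
    (bound := fun t => |t| * ((‖r‖ + 1) * |t| * exp ((‖r‖ + 1) * |t|)) * ‖v t‖)
    (Metric.ball_mem_nhds r one_pos) ?_ ?_ ?_ ?_ ?_ ?_).2
  · exact Filter.Eventually.of_forall fun z =>
      Continuous.aestronglyMeasurable (by fun_prop)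
  · exact Continuous.intervalIntegrable (by fun_prop) _ _
  · exact Continuous.aestronglyMeasurable (by fun_prop)
  · refine Filter.Eventually.of_forall fun t _ z hz => ?_
    have hz' : ‖z‖ ≤ ‖r‖ + 1 := by
      have h1 : ‖z - r‖ < 1 := by simpa [dist_eq_norm] using hz
      have h2 := norm_sub_norm_le z r
      linarith
    have hzt : ‖z * t‖ ≤ (‖r‖ + 1) * |t| := by
      rw [norm_mul, Complex.norm_real, Real.norm_eq_abs]; gcongr
    rw [norm_mul, norm_neg, norm_mul, Complex.norm_real, Real.norm_eq_abs]
    have := (norm_sin_le (z * t)).trans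
      (mul_le_mul hzt (exp_le_exp.2 hzt) (exp_pos _).le (by positivity))
    gcongr
  · exact Continuous.intervalIntegrable (by fun_prop) _ _
  · refine Filter.Eventually.of_forall fun t _ z _ => ?_
    have h1 : HasDerivAt (fun z : ℂ => z * t) (t : ℂ) z := by
      simpa using (hasDerivAt_id z).mul_const (t : ℂ)
    refine (h1.ccos.mul_const (v t)).congr_deriv ?_
    ring

/-! ### Operators on bounded sequences given by infinite matrices -/

theorem summable_matrix_mul {ι : Type*} {h : ι → ι → ℂ} {C : ℝ}
    (hC : ∀ i (s : Finset ι), ∑ j ∈ s, ‖h i j‖ ≤ C) (f : lp (fun _ : ι => ℂ) ∞) (i : ι) :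
    Summable (fun j => h i j * f j) := by
  have hs : Summable fun j => ‖h i j‖ := summable_of_sum_le (fun _ => norm_nonneg _) (hC i)
  refine Summable.of_norm_bounded (hs.mul_right ‖f‖) fun j => ?_
  rw [norm_mul]
  exact mul_le_mul_of_nonneg_left (lp.norm_apply_le_norm ENNReal.top_ne_zero f j) (norm_nonneg _)

theorem norm_tsum_matrix_mul_le {ι : Type*} {h : ι → ι → ℂ} {C : ℝ}
    (hC : ∀ i (s : Finset ι), ∑ j ∈ s, ‖h i j‖ ≤ C) (f : lp (fun _ : ι => ℂ) ∞) (i : ι) :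
    ‖∑' j, h i j * f j‖ ≤ C * ‖f‖ := by
  refine (summable_matrix_mul hC f i).hasSum.norm_le_of_bounded
    ((summable_of_sum_le (fun _ => norm_nonneg _) (hC i)).hasSum.mul_right ‖f‖) (fun j => ?_)
    |>.trans ?_
  · rw [norm_mul]
    exact mul_le_mul_of_nonneg_left (lp.norm_apply_le_norm ENNReal.top_ne_zero f j) (norm_nonneg _)
  · have : ∑' j, ‖h i j‖ ≤ C := Real.tsum_le_of_sum_le (fun _ => norm_nonneg _) (hC i)
    exact mul_le_mul_of_nonneg_right this (norm_nonneg _)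

theorem exists_clm_of_row_sums_le {ι : Type*} {h : ι → ι → ℂ} {C : ℝ}
    (hC : ∀ i (s : Finset ι), ∑ j ∈ s, ‖h i j‖ ≤ C) :
    ∃ H : lp (fun _ : ι => ℂ) ∞ →L[ℂ] lp (fun _ : ι => ℂ) ∞,
      ∀ f i, HasSum (fun j => h i j * f j) (H f i) := by
  have hmem : ∀ f : lp (fun _ : ι => ℂ) ∞, Memℓp (fun i => ∑' j, h i j * f j) ∞ := fun f =>
    memℓp_infty ⟨C * ‖f‖, by
      rintro _ ⟨i, rfl⟩
      exact norm_tsum_matrix_mul_le hC f i⟩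
  have hs := fun f i => (summable_matrix_mul hC f i)
  let L : lp (fun _ : ι => ℂ) ∞ →ₗ[ℂ] lp (fun _ : ι => ℂ) ∞ :=
    { toFun := fun f => ⟨fun i => ∑' j, h i j * f j, hmem f⟩
      map_add' := fun f g => by
        ext i
        change ∑' j, h i j * (f + g) j = (∑' j, h i j * f j) + ∑' j, h i j * g j
        rw [← (hs f i).tsum_add (hs g i)]
        simp only [lp.coeFn_add, Pi.add_apply, mul_add]
      map_smul' := fun a f => by
        ext i
        change ∑' j, h i j * (a • f) j = a * ∑' j, h i j * f j
        rw [← tsum_mul_left]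
        congr 1; ext j
        simp only [lp.coeFn_smul, Pi.smul_apply, smul_eq_mul]; ring }
  -- `C` may be negative when `ι` is empty.
  refine ⟨L.mkContinuous (max C 0) fun f => ?_, fun f i => (hs f i).hasSum⟩
  refine lp.norm_le_of_forall_le (by positivity) fun i => ?_
  exact (norm_tsum_matrix_mul_le hC f i).trans
    (mul_le_mul_of_nonneg_right (le_max_left _ _) (norm_nonneg _))

/-! ### Functionals of square-summable cosine series -/

/-- The space `l₂` of cosine coefficients. -/
abbrev CosCoeff : Type := lp (fun _ : ℕ => ℂ) 2

/-- The pairing of `∑ c_j cos (j t)` with `u`. -/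
def seriesPair (c : CosCoeff) (u : ℝ → ℂ) : ℂ := ∑' j, c j * pair u (cosN j)

/-- The conjugation turns the bilinear series `seriesPair` into a Hilbert space inner product, from
which its convergence and the Cauchy–Schwarz bound follow. -/
theorem exists_cosine_coeff {u : ℝ → ℂ} (hu : Continuous u) {M : ℝ}
    (hM : ∀ t ∈ Set.Icc 0 π, ‖u t‖ ≤ M) :
    ∃ w : CosCoeff, ‖w‖ ≤ π * M ∧ ∀ j, w j = conj (pair u (cosN j)) := by
  have hM0 : 0 ≤ M := (norm_nonneg _).trans (hM 0 ⟨le_rfl, pi_pos.le⟩)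
  have hb : ∀ s : Finset ℕ,
      ∑ j ∈ s, ‖conj (pair u (cosN j))‖ ^ (2 : ℝ≥0∞).toReal ≤ (π * M) ^ (2 : ℝ≥0∞).toReal := by
    intro s
    simpa using bessel_cos hu hM s
  refine ⟨⟨fun j => conj (pair u (cosN j)), memℓp_gen' hb⟩, ?_, fun j => rfl⟩
  exact lp.norm_le_of_forall_sum_le (by norm_num) (by positivity) hb

theorem exists_bound_on_Icc {u : ℝ → ℂ} (hu : Continuous u) :
    ∃ M, ∀ t ∈ Set.Icc 0 π, ‖u t‖ ≤ M :=
  isCompact_Icc.exists_bound_of_continuousOn hu.continuousOn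

theorem hasSum_seriesPair (c : CosCoeff) {u : ℝ → ℂ} (hu : Continuous u) :
    HasSum (fun j => c j * pair u (cosN j)) (seriesPair c u) := by
  obtain ⟨M, hM⟩ := exists_bound_on_Icc hu
  obtain ⟨w, -, hw⟩ := exists_cosine_coeff hu hM
  have h := lp.hasSum_inner (𝕜 := ℂ) w c
  simp only [hw, RCLike.inner_apply, Complex.conj_conj] at h
  exact h.summable.hasSum

theorem norm_seriesPair_le (c : CosCoeff) {u : ℝ → ℂ} (hu : Continuous u) {M : ℝ}
    (hM : ∀ t ∈ Set.Icc 0 π, ‖u t‖ ≤ M) : ‖seriesPair c u‖ ≤ π * M * ‖c‖ := by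
  obtain ⟨w, hwn, hw⟩ := exists_cosine_coeff hu hM
  have h := lp.hasSum_inner (𝕜 := ℂ) w c
  simp only [hw, RCLike.inner_apply, Complex.conj_conj] at h
  rw [(hasSum_seriesPair c hu).unique h]
  exact (norm_inner_le_norm w c).trans (mul_le_mul_of_nonneg_right hwn (norm_nonneg _))

theorem seriesPair_add_left (c d : CosCoeff) {u : ℝ → ℂ} (hu : Continuous u) :
    seriesPair (c + d) u = seriesPair c u + seriesPair d u := by
  refine (hasSum_seriesPair (c + d) hu).unique ?_
  simpa only [lp.coeFn_add, Pi.add_apply, add_mul]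
    using (hasSum_seriesPair c hu).add (hasSum_seriesPair d hu)

theorem seriesPair_smul_left (a : ℂ) (c : CosCoeff) {u : ℝ → ℂ} (hu : Continuous u) :
    seriesPair (a • c) u = a * seriesPair c u := by
  refine (hasSum_seriesPair (a • c) hu).unique ?_
  simpa only [lp.coeFn_smul, Pi.smul_apply, smul_eq_mul, mul_assoc]
    using (hasSum_seriesPair c hu).mul_left a

theorem seriesPair_sub_right (c : CosCoeff) {u v : ℝ → ℂ} (hu : Continuous u)
    (hv : Continuous v) :
    seriesPair c (fun t => u t - v t) = seriesPair c u - seriesPair c v := by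
  refine (hasSum_seriesPair c (u := fun t => u t - v t) (hu.sub hv)).unique ?_
  simpa only [pair_sub_left hu hv (continuous_cosN _), mul_sub]
    using (hasSum_seriesPair c hu).sub (hasSum_seriesPair c hv)

theorem seriesPair_smul_right (a : ℂ) (c : CosCoeff) {u : ℝ → ℂ} (hu : Continuous u) :
    seriesPair c (fun t => a * u t) = a * seriesPair c u := by
  refine (hasSum_seriesPair c (u := fun t => a * u t) (continuous_const.mul hu)).unique ?_
  have := (hasSum_seriesPair c hu).mul_left a
  simp only [mul_left_comm a] at this
  simpa only [pair_smul_left] using this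

theorem seriesPair_cosN (c : CosCoeff) (j : ℕ) :
    seriesPair c (cosN j) = c j * if j = 0 then (π : ℂ) else (π : ℂ) / 2 := by
  refine (hasSum_seriesPair c (continuous_cosN j)).unique ?_
  convert hasSum_single j fun i hi => ?_ using 1
  · rw [pair_comm, pair_cosN_cosN, if_pos rfl]
  · rw [pair_comm, pair_cosN_cosN, if_neg hi, mul_zero]

/-- The functional `c ↦ ⟨∑ c_j cos (j t), u⟩`. -/
def seriesPairₗ (u : ℝ → ℂ) (hu : Continuous u) : CosCoeff →ₗ[ℂ] ℂ where
  toFun c := seriesPair c u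
  map_add' c d := seriesPair_add_left c d hu
  map_smul' a c := seriesPair_smul_left a c hu

/-- A small system of functions gives a small operator on `l₂`. -/
theorem exists_clm_seriesPair {v : ℕ → ℝ → ℂ} (hv : ∀ j, Continuous (v j)) {M : ℕ → ℝ}
    (hM : ∀ j, ∀ t ∈ Set.Icc 0 π, ‖v j t‖ ≤ M j) {δ : ℝ} (hδ : 0 ≤ δ)
    (hsum : ∀ s : Finset ℕ, ∑ j ∈ s, M j ^ 2 ≤ δ ^ 2) :
    ∃ K : CosCoeff →L[ℂ] CosCoeff, ‖K‖ ≤ π * δ ∧ ∀ c j, K c j = seriesPair c (v j) := by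
  have hb : ∀ (c : CosCoeff) (s : Finset ℕ), ∑ j ∈ s, ‖seriesPair c (v j)‖ ^ (2 : ℝ≥0∞).toReal
      ≤ (π * δ * ‖c‖) ^ (2 : ℝ≥0∞).toReal := by
    intro c s
    simp only [ENNReal.toReal_ofNat, Real.rpow_ofNat]
    calc _ ≤ ∑ j ∈ s, (π * M j * ‖c‖) ^ 2 := by
          refine Finset.sum_le_sum fun j _ => ?_
          have := norm_seriesPair_le c (hv j) (hM j)
          gcongr
      _ = (π * ‖c‖) ^ 2 * ∑ j ∈ s, M j ^ 2 := by
          rw [Finset.mul_sum]; exact Finset.sum_congr rfl fun j _ => by ring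
      _ ≤ (π * ‖c‖) ^ 2 * δ ^ 2 := by have := hsum s; gcongr
      _ = _ := by ring
  let L : CosCoeff →ₗ[ℂ] CosCoeff :=
    { toFun := fun c => ⟨fun j => seriesPair c (v j), memℓp_gen' (hb c)⟩
      map_add' := fun c d => by
        ext j; exact seriesPair_add_left c d (hv j)
      map_smul' := fun a c => by
        ext j; exact seriesPair_smul_left a c (hv j) }
  refine ⟨L.mkContinuous (π * δ) fun c => ?_, ?_, fun c j => rfl⟩
  · exact lp.norm_le_of_forall_sum_le (by norm_num) (by positivity) (hb c)
  · exact LinearMap.mkContinuous_norm_le _ (by positivity) _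

/-- If the `g_j`, `j ≥ N`, are quadratically close to `cos (j t)`, then there is a non-trivial
cosine series orthogonal to them and to fewer than `N` further functions. -/
theorem exists_ne_zero_seriesPair_eq_zero {N : ℕ} {g : ℕ → ℝ → ℂ} (hg : ∀ j, Continuous (g j))
    {M : ℕ → ℝ} (hM : ∀ j, N ≤ j → ∀ t ∈ Set.Icc 0 π, ‖g j t - cosN j t‖ ≤ M j)
    {δ : ℝ} (hδ : 0 ≤ δ) (hδ2 : 2 * δ < 1)
    (hsum : ∀ s : Finset ℕ, (∀ j ∈ s, N ≤ j) → ∑ j ∈ s, M j ^ 2 ≤ δ ^ 2)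
    {κ : Type*} [Fintype κ] (hκ : Fintype.card κ < N) {w : κ → ℝ → ℂ}
    (hw : ∀ i, Continuous (w i)) :
    ∃ c : CosCoeff, c ≠ 0 ∧ (∀ j, N ≤ j → seriesPair c (g j) = 0) ∧
      ∀ i, seriesPair c (w i) = 0 := by
  have hN : 0 < N := by omega
  -- Since `∫ cos² jt = π/2` for `j ≥ 1`, this choice makes `1 - K` send `c` to the sequence `(2/π)
  -- ∫ f g_j` for `j ≥ N` and `c_j` for `j < N`. The norm of `K` is at most `π · (2/π) δ = 2δ < 1`.
  let v : ℕ → ℝ → ℂ := fun j t => if N ≤ j then (-(2 / π) : ℂ) * (g j t - cosN j t) else 0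
  have hvj : ∀ j, N ≤ j → v j = fun t => (-(2 / π) : ℂ) * (g j t - cosN j t) := fun j hj => by
    ext t; simp only [v, if_pos hj]
  have hvj0 : ∀ j, ¬ N ≤ j → v j = fun _ => 0 := fun j hj => by
    ext t; simp only [v, if_neg hj]
  have hvc : ∀ j, Continuous (v j) := fun j => by
    by_cases hj : N ≤ j
    · rw [hvj j hj]; exact continuous_const.mul ((hg j).sub (continuous_cosN j))
    · rw [hvj0 j hj]; exact continuous_const
  obtain ⟨K, hKn, hK⟩ := exists_clm_seriesPair (v := v) hvc
    (M := fun j => if N ≤ j then 2 / π * M j else 0) (δ := 2 / π * δ) (by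
      intro j t ht
      by_cases hj : N ≤ j
      · rw [hvj j hj, if_pos hj, norm_mul, norm_neg, norm_div, Complex.norm_ofNat,
          Complex.norm_real, norm_of_nonneg pi_pos.le]
        exact mul_le_mul_of_nonneg_left (hM j hj t ht) (by positivity)
      · rw [hvj0 j hj, if_neg hj, norm_zero]) (by positivity) (by
      intro s
      have h1 : ∑ j ∈ s, (if N ≤ j then 2 / π * M j else 0) ^ 2
          = (2 / π) ^ 2 * ∑ j ∈ s with N ≤ j, M j ^ 2 := by
        rw [Finset.sum_filter, Finset.mul_sum]
        refine Finset.sum_congr rfl fun j _ => ?_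
        split_ifs <;> ring
      rw [h1, mul_pow]
      exact mul_le_mul_of_nonneg_left (hsum _ fun j hj => (Finset.mem_filter.1 hj).2)
        (by positivity))
  have hK1 : ‖K‖ < 1 := by
    refine hKn.trans_lt ?_
    have : π * (2 / π * δ) = 2 * δ := by field_simp
    rw [this]; exact hδ2
  obtain ⟨T, hT⟩ := isUnit_one_sub_of_norm_lt_one hK1
  have hpi : (π : ℂ) ≠ 0 := by exact_mod_cast pi_ne_zero
  have hTj : ∀ c j, N ≤ j → (T : CosCoeff →L[ℂ] CosCoeff) c j = 2 / π * seriesPair c (g j) := by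
    intro c j hj
    have h0 : j ≠ 0 := by omega
    have h1 : (T : CosCoeff →L[ℂ] CosCoeff) c j = c j - K c j := by rw [hT]; rfl
    rw [h1, hK, hvj j hj, seriesPair_smul_right _ _ (u := fun t => g j t - cosN j t)
        ((hg j).sub (continuous_cosN j)),
      seriesPair_sub_right c (hg j) (continuous_cosN j), seriesPair_cosN, if_neg h0]
    field_simp; ring
  -- Preimages under `T = 1 - K` of sequences supported on the first `N` coordinates are exactly the
  -- series orthogonal to all `g_j`, `j ≥ N`.
  let ι : (Fin N → ℂ) →ₗ[ℂ] CosCoeff :=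
    Fintype.linearCombination ℂ (fun i : Fin N => lp.single 2 (i : ℕ) (1 : ℂ))
  have hι : ∀ x (j : ℕ), ι x j = ∑ i : Fin N, x i * (if j = i then 1 else 0) := by
    intro x j
    simp only [ι, Fintype.linearCombination_apply, lp.coeFn_sum, Finset.sum_apply, lp.coeFn_smul,
      Pi.smul_apply, smul_eq_mul, lp.single_apply, Pi.single_apply]
  let Ti : CosCoeff →L[ℂ] CosCoeff :=
    ((T⁻¹ : (CosCoeff →L[ℂ] CosCoeff)ˣ) : CosCoeff →L[ℂ] CosCoeff)
  have hTTi : ∀ c, (T : CosCoeff →L[ℂ] CosCoeff) (Ti c) = c := fun c =>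
    congrArg (fun A : CosCoeff →L[ℂ] CosCoeff => A c) T.mul_inv
  let Φ : (Fin N → ℂ) →ₗ[ℂ] (κ → ℂ) :=
    (LinearMap.pi fun i => seriesPairₗ (w i) (hw i)) ∘ₗ Ti.toLinearMap ∘ₗ ι
  have hker : LinearMap.ker Φ ≠ ⊥ := LinearMap.ker_ne_bot_of_finrank_lt (by simpa using hκ)
  obtain ⟨x, hx, hx0⟩ := (Submodule.ne_bot_iff _).1 hker
  refine ⟨Ti (ι x), fun h => hx0 ?_, fun j hj => ?_, fun i => ?_⟩
  · have h1 : ι x = 0 := by rw [← hTTi (ι x), h, map_zero]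
    ext i
    have h2 : ι x (i : ℕ) = 0 := by rw [h1]; rfl
    rw [hι, Finset.sum_eq_single i] at h2
    · simpa using h2
    · intro k _ hk
      rw [if_neg fun h => hk (Fin.ext h.symm), mul_zero]
    · simp
  · have h1 := hTj (Ti (ι x)) j hj
    rw [hTTi, hι, Finset.sum_eq_zero] at h1
    · have h2 : (2 / π : ℂ) ≠ 0 := by simp [hpi]
      exact (mul_eq_zero.1 h1.symm).resolve_left h2
    · intro i _
      rw [if_neg (by have := i.2; omega), mul_zero]
  · exact congrFun (LinearMap.mem_ker.1 hx) i

/-! ### The spectral data -/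

/-- `ρ̃_n` as a natural number: `0` for `n ≤ p + 1` and `n - p - 1` otherwise. -/
def modelIndex (p : ℕ) (n : ℕ+) : ℕ := n - (p + 1)

theorem model_rho (p : ℕ) (n : ℕ+) : (model p).rho n = modelIndex p n := by
  unfold SpectralData.rho model modelIndex
  dsimp only
  split_ifs with h
  · have h0 : (n : ℕ) - (p + 1) = 0 := by omega
    rw [h0]
    simpa using root_natCast_sq 0
  · have h1 : (((n : ℕ) - (p + 1) : ℕ) : ℂ) = (n : ℂ) - p - 1 := by
      rw [Nat.cast_sub (by omega)]; push_cast; ring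
    rw [← h1]
    exact root_natCast_sq _

/-- `φ̃(t, λ_n) = cos (ρ_n t)`. -/
def cosRho (S : SpectralData) (n : ℕ+) (t : ℝ) : ℂ := Complex.cos (S.rho n * t)

theorem continuous_cosRho (S : SpectralData) (n : ℕ+) : Continuous (cosRho S n) := by
  unfold cosRho; fun_prop

theorem cosRho_model (p : ℕ) (n : ℕ+) : cosRho (model p) n = cosN (modelIndex p n) := by
  ext t; rw [cosRho, model_rho, cosN]

theorem rho_eq (p : ℕ) (S : SpectralData) (n : ℕ+) :
    S.rho n = ((modelIndex p n : ℝ) : ℂ) + rhoHat p S n := by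
  rw [rhoHat, model_rho]; push_cast; ring

theorem Q_eq_pair (p : ℕ) (S : SpectralData) (n : ℕ+) (i : Fin 2) (k : ℕ+) (j : Fin 2) :
    Q p S π n i k j =
      (data p S j).alpha k * pair (cosRho (data p S i) n) (cosRho (data p S j) k) := rfl

theorem Qdot_eq_pair (p : ℕ) (S : SpectralData) (n : ℕ+) (k : ℕ+) (j : Fin 2) :
    Qdot p S π n k j = (data p S j).alpha k *
      pair (fun t => -(t * Complex.sin (S.rho n * t))) (cosRho (data p S j) k) := by
  have h : (fun r : ℂ => Qfun p S π (r ^ 2) k j) = fun r : ℂ => (data p S j).alpha k *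
      pair (fun t => Complex.cos (r * t)) (cosRho (data p S j) k) := by
    ext r
    simp only [Qfun, D, phi_sq]
    rfl
  rw [Qdot, h]
  exact ((hasDerivAt_pair_cos (continuous_cosRho _ k) _).const_mul _).deriv

/-! ### Factorization of the matrix through functions on `[0, π]` -/

open Classical in
/-- The functions pairing with which yields the rows of the matrix `H̃(π)`. -/
def rowFun (p : ℕ) (S : SpectralData) (n : ℕ+) (i : Fin 2) (t : ℝ) : ℂ :=
  if i = 0 then
    if rhoHat p S n ≠ 0 then (rhoHat p S n)⁻¹ * (cosRho S n t - cosN (modelIndex p n) t)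
    else -(t * Complex.sin (S.rho n * t))
  else cosN (modelIndex p n) t

/-- The functions pairing with which yields the columns of the matrix `H̃(π)`. -/
def colFun (p : ℕ) (S : SpectralData) (k : ℕ+) (j : Fin 2) (t : ℝ) : ℂ :=
  if j = 0 then S.alpha k * rhoHat p S k * cosRho S k t
  else S.alpha k * cosRho S k t - (model p).alpha k * cosN (modelIndex p k) t

theorem rowFun_zero_of_ne {p : ℕ} {S : SpectralData} {n : ℕ+} (h : rhoHat p S n ≠ 0) :
    rowFun p S n 0 =
      fun t => (rhoHat p S n)⁻¹ * (cosRho S n t - cosN (modelIndex p n) t) := by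
  ext t; simp [rowFun, h]

theorem rowFun_zero_of_eq {p : ℕ} {S : SpectralData} {n : ℕ+} (h : rhoHat p S n = 0) :
    rowFun p S n 0 = fun t : ℝ => -(t * Complex.sin (S.rho n * t)) := by
  ext t; simp [rowFun, h]

theorem rowFun_one (p : ℕ) (S : SpectralData) (n : ℕ+) :
    rowFun p S n 1 = cosN (modelIndex p n) := by
  ext t; simp [rowFun]

theorem colFun_zero (p : ℕ) (S : SpectralData) (k : ℕ+) :
    colFun p S k 0 = fun t => S.alpha k * rhoHat p S k * cosRho S k t := by
  ext t; simp [colFun]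

theorem colFun_one (p : ℕ) (S : SpectralData) (k : ℕ+) : colFun p S k 1 =
    fun t => S.alpha k * cosRho S k t - (model p).alpha k * cosN (modelIndex p k) t := by
  ext t; simp [colFun]

theorem continuous_rowFun (p : ℕ) (S : SpectralData) (n : ℕ+) (i : Fin 2) :
    Continuous (rowFun p S n i) := by
  have h1 := continuous_cosRho S n
  have h2 := continuous_cosN (modelIndex p n)
  fin_cases i
  · by_cases h : rhoHat p S n = 0
    · change Continuous (rowFun p S n 0)
      rw [rowFun_zero_of_eq h]; fun_prop
    · change Continuous (rowFun p S n 0)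
      rw [rowFun_zero_of_ne h]; fun_prop
  · change Continuous (rowFun p S n 1)
    rw [rowFun_one]; exact h2

theorem pair_colFun_zero (p : ℕ) (S : SpectralData) (k : ℕ+) (u : ℝ → ℂ) :
    pair u (colFun p S k 0) = S.alpha k * rhoHat p S k * pair u (cosRho S k) := by
  rw [pair_comm, colFun_zero, pair_smul_left, pair_comm]

theorem pair_colFun_one (p : ℕ) (S : SpectralData) (k : ℕ+) {u : ℝ → ℂ} (hu : Continuous u) :
    pair u (colFun p S k 1) = S.alpha k * pair u (cosRho S k)
      - (model p).alpha k * pair u (cosN (modelIndex p k)) := by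
  have h1 := continuous_cosRho S k
  have h2 := continuous_cosN (modelIndex p k)
  rw [pair_comm, colFun_one, pair_sub_left (by fun_prop) (by fun_prop) hu, pair_smul_left,
    pair_smul_left, pair_comm u, pair_comm u]

/-- The left matrix factor acts only on the first argument of the pairing and the right factor only
on the second, so bilinearity absorbs them into the row and column functions. -/
theorem Hblock_eq_pair (p : ℕ) (S : SpectralData) (n k : ℕ+) (i j : Fin 2) :
    Hblock p S π n k i j = pair (rowFun p S n i) (colFun p S k j) := by
  have h1 := continuous_cosRho S n
  have h2 := continuous_cosN (modelIndex p n)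
  have d0 : data p S 0 = S := rfl
  have d1 : data p S 1 = model p := rfl
  have key : ∀ v : ℝ → ℂ, Continuous v → rhoHat p S n ≠ 0 → pair (rowFun p S n 0) v =
      (rhoHat p S n)⁻¹ * (pair (cosRho S n) v - pair (cosN (modelIndex p n)) v) := by
    intro v hv h
    rw [rowFun_zero_of_ne h, pair_smul_left, pair_sub_left h1 h2 hv]
  unfold Hblock
  split_ifs with h
  · fin_cases i <;> fin_cases j <;>
    simp only [Fin.zero_eta, Fin.mk_one, Fin.isValue, pair_colFun_zero,
      pair_colFun_one p S k (continuous_rowFun p S n _), rowFun_one,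
      pair_colFun_one p S k (continuous_cosN _), key _ (continuous_cosRho S k) h,
      key _ (continuous_cosN _) h, T, Tinv, Matrix.mul_apply,
      Fin.sum_univ_two, Q_eq_pair, d0, d1, cosRho_model, Matrix.of_apply, Matrix.cons_val_zero,
      Matrix.cons_val_one, Matrix.cons_val', Matrix.cons_val_fin_one] <;> ring
  · push Not at h
    have hq : ∀ j, Qdot p S π n k j =
        (data p S j).alpha k * pair (rowFun p S n 0) (cosRho (data p S j) k) := fun j => by
      rw [Qdot_eq_pair, rowFun_zero_of_eq h]
    fin_cases i <;> fin_cases j <;>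
    simp only [Fin.zero_eta, Fin.mk_one, Fin.isValue, pair_colFun_zero,
      pair_colFun_one p S k (continuous_rowFun p S n _), rowFun_one,
      pair_colFun_one p S k (continuous_cosN _), Tinv, Matrix.mul_apply, hq,
      Fin.sum_univ_two, Q_eq_pair, d0, d1, cosRho_model, Matrix.of_apply, Matrix.cons_val_zero,
      Matrix.cons_val_one, Matrix.cons_val', Matrix.cons_val_fin_one] <;> ring

/-! ### Uniform bounds for the row functions and the model weights -/

theorem norm_cosN_le (j : ℕ) (t : ℝ) : ‖cosN j t‖ ≤ 1 := by
  have := norm_ofReal_cos_le (j * t)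
  simpa [cosN] using this

theorem norm_sinN_le (j : ℕ) (t : ℝ) : ‖sinN j t‖ ≤ 1 := by
  have := norm_ofReal_sin_le (j * t)
  simpa [sinN] using this

theorem norm_cosRho_sub_le {p : ℕ} {S : SpectralData} {R : ℝ} {n : ℕ+}
    (hR : ‖rhoHat p S n‖ ≤ R) {t : ℝ} (ht : t ∈ Set.Icc 0 π) :
    ‖cosRho S n t - cosN (modelIndex p n) t‖ ≤ trigConst R * ‖rhoHat p S n‖ := by
  have := norm_cos_sub_cos_le (modelIndex p n) hR ht
  rw [← rho_eq] at this
  simpa only [cosRho, cosN, Complex.ofReal_natCast] using this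

theorem norm_cosRho_sub_add_le {p : ℕ} {S : SpectralData} {R : ℝ} {n : ℕ+}
    (hR : ‖rhoHat p S n‖ ≤ R) {t : ℝ} (ht : t ∈ Set.Icc 0 π) :
    ‖cosRho S n t - cosN (modelIndex p n) t + rhoHat p S n * (t * sinN (modelIndex p n) t)‖
      ≤ trigConst R * ‖rhoHat p S n‖ ^ 2 := by
  have := norm_cos_sub_cos_add_le (modelIndex p n) hR ht
  rw [← rho_eq] at this
  simpa only [cosRho, cosN, sinN, Complex.ofReal_natCast] using this

theorem norm_rowFun_le {p : ℕ} {S : SpectralData} {R : ℝ} (hR : ∀ n, ‖rhoHat p S n‖ ≤ R)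
    (n : ℕ+) (i : Fin 2) {t : ℝ} (ht : t ∈ Set.Icc 0 π) :
    ‖rowFun p S n i t‖ ≤ trigConst R + π + 1 := by
  have hT := trigConst_nonneg ((norm_nonneg _).trans (hR n))
  have hpi := pi_pos
  fin_cases i
  · by_cases h : rhoHat p S n = 0
    · change ‖rowFun p S n 0 t‖ ≤ _
      rw [rowFun_zero_of_eq h, rho_eq p S n, h, add_zero]
      have h1 := norm_sinN_le (modelIndex p n) t
      simp only [sinN, Complex.ofReal_natCast, norm_neg, norm_mul, Complex.norm_real,
        norm_of_nonneg ht.1] at h1 ⊢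
      nlinarith [ht.1, ht.2]
    · change ‖rowFun p S n 0 t‖ ≤ _
      rw [rowFun_zero_of_ne h, norm_mul, norm_inv]
      have h1 := norm_cosRho_sub_le (hR n) ht
      have h2 : 0 < ‖rhoHat p S n‖ := norm_pos_iff.2 h
      rw [inv_mul_le_iff₀ h2]
      nlinarith
  · change ‖rowFun p S n 1 t‖ ≤ _
    rw [rowFun_one]
    have := norm_cosN_le (modelIndex p n) t
    linarith

theorem norm_model_alpha_le (p : ℕ) (k : ℕ+) : ‖(model p).alpha k‖ ≤ 1 := by
  have h3 := pi_gt_three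
  have h1 : ‖(1 / π : ℂ)‖ ≤ 1 := by
    rw [norm_div, norm_one, Complex.norm_real, norm_of_nonneg pi_pos.le, div_le_one pi_pos]
    linarith
  have h2 : ‖(2 / π : ℂ)‖ ≤ 1 := by
    rw [norm_div, Complex.norm_ofNat, Complex.norm_real, norm_of_nonneg pi_pos.le,
      div_le_one pi_pos]
    linarith
  unfold model
  dsimp only
  split_ifs
  · exact h1
  · simp
  · exact h2

/-! ### Row sums of the matrix -/

/-- Every contribution is a product of two of the four quantities on the right, up to a constant,
and `x y ≤ x² + y²` applies. Each of these squares is summable over `k`. -/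
theorem norm_pair_colFun_le {p : ℕ} {S : SpectralData} {R a M : ℝ} {k : ℕ+}
    (hR : ‖rhoHat p S k‖ ≤ R) (ha : ‖S.alpha k‖ ≤ a) {u : ℝ → ℂ} (hu : Continuous u)
    (hM : ∀ t ∈ Set.Icc 0 π, ‖u t‖ ≤ M) (j : Fin 2) :
    ‖pair u (colFun p S k j)‖ ≤ (a + 1) * (1 + 2 * (π * (M * trigConst R))) *
      (‖rhoHat p S k‖ ^ 2 + ‖S.alpha k - (model p).alpha k‖ ^ 2
        + ‖pair u (cosN (modelIndex p k))‖ ^ 2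
        + ‖pair (fun t => t * u t) (sinN (modelIndex p k))‖ ^ 2) := by
  have h1 := continuous_cosRho S k
  have h2 := continuous_cosN (modelIndex p k)
  have h3 := continuous_sinN (modelIndex p k)
  have hM0 : 0 ≤ M := (norm_nonneg _).trans (hM 0 ⟨le_rfl, pi_pos.le⟩)
  have ha0 : 0 ≤ a := (norm_nonneg _).trans ha
  have hT := trigConst_nonneg ((norm_nonneg _).trans hR)
  set E := π * (M * trigConst R) with hE
  have hE0 : 0 ≤ E := by have := pi_pos; positivity
  set r := ‖rhoHat p S k‖ with hr
  set d := ‖S.alpha k - (model p).alpha k‖ with hd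
  set b := ‖pair u (cosN (modelIndex p k))‖ with hb
  set b' := ‖pair (fun t => t * u t) (sinN (modelIndex p k))‖ with hb'
  have hr0 : 0 ≤ r := norm_nonneg _
  have hd0 : 0 ≤ d := norm_nonneg _
  have hb0 : 0 ≤ b := norm_nonneg _
  have hb0' : 0 ≤ b' := norm_nonneg _
  have hdiff : pair u (fun t => cosRho S k t - cosN (modelIndex p k) t)
      = pair u (cosRho S k) - pair u (cosN (modelIndex p k)) := by
    rw [pair_comm, pair_sub_left h1 h2 hu, pair_comm u, pair_comm u]
  have hrem : pair u (fun t => cosRho S k t - cosN (modelIndex p k) t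
      + rhoHat p S k * (t * sinN (modelIndex p k) t))
      = pair u (cosRho S k) - pair u (cosN (modelIndex p k))
        + rhoHat p S k * pair (fun t => t * u t) (sinN (modelIndex p k)) := by
    rw [pair_comm, pair_add_left (u := fun t => cosRho S k t - cosN (modelIndex p k) t)
      (by fun_prop) (by fun_prop) hu, pair_smul_left, pair_comm, hdiff]
    congr 2
    unfold pair
    congr 1; ext t; ring
  have hA : ‖pair u (cosRho S k) - pair u (cosN (modelIndex p k))‖ ≤ E * r := by
    rw [← hdiff]
    refine (norm_pair_le hM fun t ht => norm_cosRho_sub_le hR ht).trans (le_of_eq ?_)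
    rw [hE]; ring
  have hB : ‖pair u (cosRho S k) - pair u (cosN (modelIndex p k))
        + rhoHat p S k * pair (fun t => t * u t) (sinN (modelIndex p k))‖ ≤ E * r ^ 2 := by
    rw [← hrem]
    refine (norm_pair_le hM fun t ht => norm_cosRho_sub_add_le hR ht).trans (le_of_eq ?_)
    rw [hE]; ring
  have hA' : ‖pair u (cosRho S k)‖ ≤ b + E * r := by
    have := norm_sub_norm_le (pair u (cosRho S k)) (pair u (cosN (modelIndex p k)))
    linarith
  have hB' : ‖pair u (cosRho S k) - pair u (cosN (modelIndex p k))‖ ≤ r * b' + E * r ^ 2 := by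
    have h4 := norm_sub_norm_le (pair u (cosRho S k) - pair u (cosN (modelIndex p k)))
      (-(rhoHat p S k * pair (fun t => t * u t) (sinN (modelIndex p k))))
    rw [sub_neg_eq_add, norm_neg, norm_mul] at h4
    linarith
  have hsq : ∀ x y : ℝ, x * y ≤ x ^ 2 + y ^ 2 := fun x y => by
    nlinarith [sq_nonneg (x - y), sq_nonneg x, sq_nonneg y]
  set X := r ^ 2 + d ^ 2 + b ^ 2 + b' ^ 2 with hX
  have hX0 : 0 ≤ X := by positivity
  have hle : ∀ y, y ≤ a * ((1 + E) * X) ∨ y ≤ (1 + 2 * E) * X →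
      y ≤ (a + 1) * (1 + 2 * E) * X := by
    intro y hy
    have h5 : 0 ≤ a * X := by positivity
    have h6 : 0 ≤ E * X := by positivity
    have h7 : 0 ≤ a * (E * X) := by positivity
    rcases hy with hy | hy <;> nlinarith
  refine hle _ ?_
  fin_cases j
  · left
    change ‖pair u (colFun p S k 0)‖ ≤ _
    rw [pair_colFun_zero, norm_mul, norm_mul, mul_assoc]
    have h8 : r * (b + E * r) ≤ (1 + E) * X := by
      have := hsq r b
      have h9 : 0 ≤ E * (d ^ 2 + b ^ 2 + b' ^ 2) := by positivity
      nlinarith [sq_nonneg d, sq_nonneg b']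
    refine mul_le_mul ha ((mul_le_mul_of_nonneg_left hA' hr0).trans h8) (by positivity) ha0
  · right
    change ‖pair u (colFun p S k 1)‖ ≤ _
    -- The first summand already has the small factor `α_k - α̃_k`. In the second, `α̃_k` is merely
    -- bounded, so the second-order expansion `hB'` of the cosine difference is required.
    have h10 : pair u (colFun p S k 1) = (S.alpha k - (model p).alpha k) * pair u (cosRho S k)
        + (model p).alpha k * (pair u (cosRho S k) - pair u (cosN (modelIndex p k))) := by
      rw [pair_colFun_one p S k hu]; ring
    rw [h10]
    have h11 := norm_model_alpha_le p k
    calc _ ≤ d * (b + E * r) + 1 * (r * b' + E * r ^ 2) := by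
          refine (norm_add_le _ _).trans ?_
          rw [norm_mul, norm_mul]
          gcongr
      _ ≤ (1 + 2 * E) * X := by
          have h12 := hsq d b
          have h13 := hsq r b'
          have h14 : E * (d * r) ≤ E * (d ^ 2 + r ^ 2) := mul_le_mul_of_nonneg_left (hsq d r) hE0
          have h15 : 0 ≤ E * (d ^ 2 + 2 * b ^ 2 + 2 * b' ^ 2) := by positivity
          nlinarith

/-- A fibre of `modelIndex` over `j` lies in `[j, j + p + 1]`. The count `p + 2` is crude: the fibre
over 0 has `p + 1` elements, all others have one. -/
theorem sum_modelIndex_le (p : ℕ) {f : ℕ → ℝ} (hf : ∀ j, 0 ≤ f j) {C : ℝ}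
    (hC : ∀ s : Finset ℕ, ∑ j ∈ s, f j ≤ C) (s : Finset ℕ+) :
    ∑ k ∈ s, f (modelIndex p k) ≤ (p + 2) * C := by
  classical
  rw [Finset.sum_comp]
  calc _ ≤ ∑ j ∈ s.image (modelIndex p), ((p : ℝ) + 2) * f j := by
        refine Finset.sum_le_sum fun j _ => ?_
        rw [nsmul_eq_mul]
        refine mul_le_mul_of_nonneg_right ?_ (hf j)
        have h1 : (s.filter fun k => modelIndex p k = j).card ≤ (Finset.Icc j (j + p + 1)).card := by
          refine Finset.card_le_card_of_injOn (fun k => (k : ℕ)) (fun k hk => ?_)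
            PNat.coe_injective.injOn
          have hk' := (Finset.mem_filter.1 hk).2
          unfold modelIndex at hk'
          rw [Finset.mem_coe, Finset.mem_Icc]
          dsimp only
          omega
        rw [Nat.card_Icc] at h1
        have h2 : (s.filter fun k => modelIndex p k = j).card ≤ p + 2 := by omega
        exact_mod_cast h2
    _ ≤ _ := by
        rw [← Finset.mul_sum]
        exact mul_le_mul_of_nonneg_left (hC _) (by positivity)

/-! ### Square-summable deviations from the model data -/

theorem memlp_two_of_finite_ne {f g : ℕ+ → ℂ} (hf : Memℓp f 2) (h : {n | g n ≠ f n}.Finite) :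
    Memℓp g 2 := by
  have h1 : Memℓp (fun n => g n - f n) 2 := by
    refine (memℓp_zero (h.subset fun n hn => ?_)).of_exponent_ge zero_le
    exact fun e => hn (by simp [e])
  have h2 := hf.add h1
  convert h2 using 1
  ext n; simp

theorem finite_pnat_le (N : ℕ) : {n : ℕ+ | (n : ℕ) ≤ N}.Finite :=
  ((Set.finite_Iic N).preimage PNat.coe_injective.injOn).subset fun _ hn => hn

theorem memlp_rhoHat {p : ℕ} {S : SpectralData} (hS : S ∈ classS p) : Memℓp (rhoHat p S) 2 := by
  refine memlp_two_of_finite_ne hS.1 ((finite_pnat_le p).subset fun n hn => ?_)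
  by_contra h
  refine hn ?_
  rw [rhoHat, model_rho, modelIndex]
  have h' : ¬ (n : ℕ) ≤ p := h
  rw [Nat.cast_sub (by omega)]; push_cast; ring

theorem memlp_alpha_sub {p : ℕ} {S : SpectralData} (hS : S ∈ classS p) :
    Memℓp (fun n => S.alpha n - (model p).alpha n) 2 := by
  refine memlp_two_of_finite_ne hS.2 ((finite_pnat_le (p + 1)).subset fun n hn => ?_)
  by_contra h
  refine hn ?_
  have h' : ¬ (n : ℕ) ≤ p + 1 := h
  have h1 : n ≠ 1 := by rintro rfl; simp at h'
  simp [model, h1, h']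

theorem summable_sq_of_memlp {f : ℕ+ → ℂ} (hf : Memℓp f 2) : Summable fun n => ‖f n‖ ^ 2 := by
  simpa using hf.summable (by norm_num)

theorem exists_norm_le_of_memlp {f : ℕ+ → ℂ} (hf : Memℓp f 2) : ∃ C, ∀ n, ‖f n‖ ≤ C := by
  obtain ⟨C, hC⟩ := (hf.of_exponent_ge le_top).bddAbove
  exact ⟨C, fun n => hC ⟨n, rfl⟩⟩

theorem exists_row_sums_le {p : ℕ} {S : SpectralData} (hS : S ∈ classS p) :
    ∃ C, ∀ (ni : ℕ+ × Fin 2) (s : Finset (ℕ+ × Fin 2)),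
      ∑ kj ∈ s, ‖Hblock p S π ni.1 kj.1 ni.2 kj.2‖ ≤ C := by
  classical
  obtain ⟨R, hR⟩ := exists_norm_le_of_memlp (memlp_rhoHat hS)
  obtain ⟨d, hd⟩ := exists_norm_le_of_memlp (memlp_alpha_sub hS)
  have hs1 := summable_sq_of_memlp (memlp_rhoHat hS)
  have hs2 := summable_sq_of_memlp (memlp_alpha_sub hS)
  have ha : ∀ k, ‖S.alpha k‖ ≤ d + 1 := fun k => by
    have h1 := norm_sub_norm_le (S.alpha k) ((model p).alpha k)
    have h2 := norm_model_alpha_le p k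
    have h3 := hd k
    linarith
  set M := trigConst R + π + 1 with hMdef
  have hT := trigConst_nonneg ((norm_nonneg _).trans (hR 1))
  have hM0 : 0 ≤ M := by have := pi_pos; positivity
  have hd0 : 0 ≤ d := (norm_nonneg _).trans (hd 1)
  -- The leading 2 counts the two columns of a block, `d + 1` bounds the weights, `p + 2` is the
  -- multiplicity of `modelIndex`, and `π * M` bounds `t u(t)`.
  refine ⟨2 * ((d + 1 + 1) * (1 + 2 * (π * (M * trigConst R))) *
    (∑' k, ‖rhoHat p S k‖ ^ 2 + ∑' k, ‖S.alpha k - (model p).alpha k‖ ^ 2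
      + (p + 2) * (π * M) ^ 2 + (p + 2) * (π * (π * M)) ^ 2)), ?_⟩
  rintro ⟨n, i⟩ s
  have hu := continuous_rowFun p S n i
  have hM : ∀ t ∈ Set.Icc 0 π, ‖rowFun p S n i t‖ ≤ M := fun t ht => norm_rowFun_le hR n i ht
  have hM' : ∀ t ∈ Set.Icc 0 π, ‖(t : ℂ) * rowFun p S n i t‖ ≤ π * M := fun t ht => by
    rw [norm_mul, Complex.norm_real, norm_of_nonneg ht.1]
    exact mul_le_mul ht.2 (hM t ht) (norm_nonneg _) pi_pos.le
  simp only [Hblock_eq_pair]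
  calc _ ≤ ∑ kj ∈ s.image Prod.fst ×ˢ (Finset.univ : Finset (Fin 2)),
        ‖pair (rowFun p S n i) (colFun p S kj.1 kj.2)‖ := by
        refine Finset.sum_le_sum_of_subset_of_nonneg (fun kj hkj => ?_)
          fun _ _ _ => norm_nonneg _
        exact Finset.mem_product.2 ⟨Finset.mem_image_of_mem _ hkj, Finset.mem_univ _⟩
    _ ≤ ∑ k ∈ s.image Prod.fst, 2 * ((d + 1 + 1) * (1 + 2 * (π * (M * trigConst R))) *
      (‖rhoHat p S k‖ ^ 2 + ‖S.alpha k - (model p).alpha k‖ ^ 2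
        + ‖pair (rowFun p S n i) (cosN (modelIndex p k))‖ ^ 2
        + ‖pair (fun t => t * rowFun p S n i t) (sinN (modelIndex p k))‖ ^ 2)) := by
        rw [Finset.sum_product]
        refine Finset.sum_le_sum fun k _ => ?_
        rw [Fin.sum_univ_two, two_mul]
        exact add_le_add (norm_pair_colFun_le (hR k) (ha k) hu hM 0)
          (norm_pair_colFun_le (hR k) (ha k) hu hM 1)
    _ ≤ _ := by
        rw [← Finset.mul_sum, ← Finset.mul_sum, Finset.sum_add_distrib, Finset.sum_add_distrib,
          Finset.sum_add_distrib]
        have e1 := hs1.sum_le_tsum (s.image Prod.fst) fun _ _ => by positivity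
        have e2 := hs2.sum_le_tsum (s.image Prod.fst) fun _ _ => by positivity
        have e3 := sum_modelIndex_le p
          (f := fun j => ‖pair (rowFun p S n i) (cosN j)‖ ^ 2) (fun _ => by positivity)
          (bessel_cos hu hM) (s.image Prod.fst)
        have e4 := sum_modelIndex_le p
          (f := fun j => ‖pair (fun t => t * rowFun p S n i t) (sinN j)‖ ^ 2)
          (fun _ => by positivity)
          (bessel_sin (Complex.continuous_ofReal.mul hu) hM') (s.image Prod.fst)
        have := pi_pos
        gcongr

/-! ### The number of missing eigenvalues -/

theorem eq_of_mem_I {S : SpectralData} {k n : ℕ+} (hk : k ∈ I S) (hn : n ∈ I S)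
    (h : S.lam k = S.lam n) : k = n := by
  rcases lt_trichotomy k n with hlt | heq | hlt
  · exact absurd h.symm (hn.1 k hlt hk.2)
  · exact heq
  · exact absurd h (hk.1 n hlt hn.2)

theorem exists_mem_I {S : SpectralData} {k : ℕ+} (hk : S.alpha k ≠ 0) :
    ∃ n ∈ I S, S.lam n = S.lam k := by
  classical
  have hex : ∃ n, S.alpha n ≠ 0 ∧ S.lam n = S.lam k := ⟨k, hk, rfl⟩
  obtain ⟨h1, h2⟩ := PNat.find_spec hex
  refine ⟨PNat.find hex, ⟨fun l hl hal he => ?_, h1⟩, h2⟩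
  exact PNat.find_min hex hl ⟨hal, he.symm.trans h2⟩

/-- The set collects the indices of zero weight and, for each repeated eigenvalue, its carriers of
non-zero weight other than the representative. These indices contribute no new function `cos ρ_n t`
to the orthogonality conditions. -/
theorem exists_finset_card_eq_A_add_B {p : ℕ} {S : SpectralData} (hS : S ∈ classS p) :
    ∃ F : Finset ℕ+, F.card = A S + B S ∧ ∀ n ∈ F, n ∉ I S := by
  classical
  set Z := (A_finite hS).toFinset with hZ
  set P := (B_finite hS).toFinset.filter (· ∈ I S) with hP
  set M : ℕ+ → Finset ℕ+ := fun k => (mult_finite hS k).toFinset.erase k with hM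
  have hmemM : ∀ k n, n ∈ M k ↔ n ≠ k ∧ S.lam n = S.lam k ∧ S.alpha n ≠ 0 := fun k n => by
    simp [hM]
  have hPI : ∀ k ∈ P, k ∈ I S := fun k hk => (Finset.mem_filter.1 hk).2
  have hdisj : Disjoint Z (P.biUnion M) := by
    rw [Finset.disjoint_left]
    intro n hn hn'
    obtain ⟨k, -, hk⟩ := Finset.mem_biUnion.1 hn'
    exact ((hmemM k n).1 hk).2.2 ((A_finite hS).mem_toFinset.1 hn)
  refine ⟨Z ∪ P.biUnion M, ?_, fun n hn hI => ?_⟩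
  · rw [Finset.card_union_of_disjoint hdisj, Finset.card_biUnion]
    · congr 1
      · exact (Set.ncard_eq_toFinset_card _ (A_finite hS)).symm
      · rw [B, finsum_mem_eq_sum_filter _ _ (B_finite hS)]
        refine Finset.sum_congr rfl fun k hk => ?_
        rw [mult, Set.ncard_eq_toFinset_card _ (mult_finite hS k), hM, Finset.card_erase_of_mem]
        exact (mult_finite hS k).mem_toFinset.2 ⟨rfl, (hPI k hk).2⟩
    · intro k hk l hl hkl
      rw [Function.onFun, Finset.disjoint_left]
      intro n hn hn'
      exact hkl (eq_of_mem_I (hPI k hk) (hPI l hl)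
        (((hmemM k n).1 hn).2.1.symm.trans ((hmemM l n).1 hn').2.1))
  · rcases Finset.mem_union.1 hn with hn | hn
    · exact hI.2 ((A_finite hS).mem_toFinset.1 hn)
    · obtain ⟨k, hk, hkn⟩ := Finset.mem_biUnion.1 hn
      obtain ⟨h1, h2, -⟩ := (hmemM k n).1 hkn
      exact h1 (eq_of_mem_I hI (hPI k hk) h2)

/-! ### The kernel of `E + H̃(π)` -/

/-- The index `n` with `ρ̃_n = j`, `α̃_n ≠ 0`. -/
def modelPos (p j : ℕ) : ℕ+ := if j = 0 then 1 else (p + j).succPNat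

theorem modelPos_zero (p : ℕ) : modelPos p 0 = 1 := if_pos rfl

theorem coe_modelPos (p : ℕ) {j : ℕ} (h : j ≠ 0) : (modelPos p j : ℕ) = p + 1 + j := by
  rw [modelPos, if_neg h, Nat.succPNat_coe]; omega

theorem modelIndex_modelPos (p j : ℕ) : modelIndex p (modelPos p j) = j := by
  unfold modelIndex
  rcases eq_or_ne j 0 with rfl | h
  · simp [modelPos_zero]
  · rw [coe_modelPos p h]; omega

theorem modelPos_injective (p : ℕ) : Function.Injective (modelPos p) :=
  Function.LeftInverse.injective (g := modelIndex p) (modelIndex_modelPos p)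

/-- The non-zero model weights are the reciprocals of `∫ cos² jt`; this is what reduces the model
part of the matrix to Parseval's identity. -/
theorem model_alpha_modelPos (p j : ℕ) :
    (model p).alpha (modelPos p j) * (if j = 0 then (π : ℂ) else (π : ℂ) / 2) = 1 := by
  have hpi : (π : ℂ) ≠ 0 := by exact_mod_cast pi_ne_zero
  rcases eq_or_ne j 0 with rfl | h
  · simp [model, modelPos_zero, hpi]
  · have h0 := coe_modelPos p h
    have h1 : modelPos p j ≠ 1 := fun e => by
      rw [e, PNat.one_coe] at h0
      omega
    have h2 : ¬ (modelPos p j : ℕ) ≤ p + 1 := by omega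
    simp only [model, if_neg h, if_neg h1, if_neg h2]
    field_simp

theorem model_alpha_eq_zero {p : ℕ} {n : ℕ+} (h : n ∉ Set.range (modelPos p)) :
    (model p).alpha n = 0 := by
  have h1 : n ≠ 1 := fun e => h ⟨0, by rw [e]; rfl⟩
  have h2 : (n : ℕ) ≤ p + 1 := by
    by_contra h2
    refine h ⟨n - (p + 1), PNat.coe_injective ?_⟩
    rw [coe_modelPos p (by omega)]
    omega
  simp [model, h1, h2]

/-- If `A(S) + B(S) ≥ p + 1`, the functions `cos (ρ_n t)` with `α_n ≠ 0` are not complete. -/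
theorem exists_ne_zero_seriesPair_cosRho {p : ℕ} {S : SpectralData} (hS : S ∈ classS p)
    (hAB : p + 1 ≤ A S + B S) :
    ∃ c : CosCoeff, c ≠ 0 ∧ ∀ k, S.alpha k ≠ 0 → seriesPair c (cosRho S k) = 0 := by
  classical
  obtain ⟨R, hR⟩ := exists_norm_le_of_memlp (memlp_rhoHat hS)
  obtain ⟨F, hFcard, hF⟩ := exists_finset_card_eq_A_add_B hS
  let e : ℕ → ℕ+ := fun j => ⟨p + 1 + j, by omega⟩
  have he : Function.Injective e := fun i j h => by
    have := congrArg PNat.val h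
    simp only [e, PNat.mk_coe] at this
    omega
  have hτ : ∀ j, modelIndex p (e j) = j := fun j => by simp [modelIndex, e]
  have hsum : Summable fun j => (trigConst R * ‖rhoHat p S (e j)‖) ^ 2 := by
    simp only [mul_pow]
    exact ((summable_sq_of_memlp (memlp_rhoHat hS)).comp_injective he).mul_left _
  -- Any `δ < 1/2` would suffice for the Neumann series; `δ = 1/4` is used.
  obtain ⟨s₀, hs₀⟩ := summable_iff_vanishing_norm.1 hsum ((1 / 4) ^ 2) (by norm_num)
  obtain ⟨N₁, hN₁⟩ := s₀.bddAbove
  obtain ⟨N₂, hN₂⟩ := F.bddAbove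
  set N : ℕ := N₁ + N₂ + 1 with hN
  -- The last index before `e N = p + 1 + N`, so the tail `j ≥ N` starts right after it. The summand
  -- `N₂` in `N` places `F` inside this initial segment.
  let top : ℕ+ := ⟨p + N, by omega⟩
  let κ : Finset ℕ+ := (Finset.Icc 1 top).filter (· ∈ I S)
  have hFsub : F ⊆ Finset.Icc 1 top := fun n hn => by
    rw [Finset.mem_Icc]
    refine ⟨one_le, ?_⟩
    have h1 : (n : ℕ) ≤ N₂ := hN₂ hn
    have h2 : (n : ℕ) ≤ p + N := by omega
    exact h2
  -- The representatives avoid `F`, hence number at most `p + N - (A + B) ≤ N - 1`.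
  have hκ : Fintype.card κ < N := by
    rw [Fintype.card_coe]
    have h1 : κ ⊆ Finset.Icc 1 top \ F := fun n hn => by
      obtain ⟨h2, h3⟩ := Finset.mem_filter.1 hn
      exact Finset.mem_sdiff.2 ⟨h2, fun h => hF n h h3⟩
    have h2 := Finset.card_le_card h1
    have h3 : (Finset.Icc 1 top).card = p + N := by
      rw [PNat.card_Icc]; simp [top]
    rw [Finset.card_sdiff_of_subset hFsub, h3] at h2
    omega
  obtain ⟨c, hc0, hc1, hc2⟩ := exists_ne_zero_seriesPair_eq_zero (N := N)
    (g := fun j => cosRho S (e j)) (fun j => continuous_cosRho S (e j))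
    (M := fun j => trigConst R * ‖rhoHat p S (e j)‖) (fun j _ t ht => by
      have := norm_cosRho_sub_le (hR (e j)) ht
      rwa [hτ] at this) (δ := 1 / 4) (by norm_num) (by norm_num) (fun s hs => by
      have hd : Disjoint s s₀ := Finset.disjoint_left.2 fun j hj hj' => by
        have h1 := hs j hj
        have h2 : j ≤ N₁ := hN₁ hj'
        omega
      exact (le_abs_self _).trans (hs₀ s hd).le) hκ
    (w := fun i : κ => cosRho S i) (fun i => continuous_cosRho S i)
  refine ⟨c, hc0, fun k hk => ?_⟩
  obtain ⟨n, hnI, hn⟩ := exists_mem_I hk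
  have hcos : cosRho S k = cosRho S n := by
    unfold cosRho SpectralData.rho; rw [hn]
  rw [hcos]
  by_cases hle : n ≤ top
  · exact hc2 ⟨n, Finset.mem_filter.2 ⟨Finset.mem_Icc.2 ⟨one_le, hle⟩, hnI⟩⟩
  · have h1 : p + N < (n : ℕ) := not_le.1 hle
    have h2 : e (n - (p + 1)) = n := by
      apply PNat.coe_injective
      simp only [e, PNat.mk_coe]
      omega
    have h3 := hc1 (n - (p + 1)) (by omega)
    simp only [h2] at h3
    exact h3

/-- Undoes the divided difference; when `ρ̂_k = 0` the two cosines coincide and the derivative row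
drops out. -/
theorem seriesPair_rowFun (p : ℕ) (S : SpectralData) (c : CosCoeff) (k : ℕ+) :
    rhoHat p S k * seriesPair c (rowFun p S k 0) + seriesPair c (rowFun p S k 1)
      = seriesPair c (cosRho S k) := by
  have h1 := continuous_cosRho S k
  have h2 := continuous_cosN (modelIndex p k)
  rw [rowFun_one]
  by_cases h : rhoHat p S k = 0
  · have h3 : cosRho S k = cosN (modelIndex p k) := by
      ext t
      rw [cosRho, cosN, rho_eq p S k, h]
      simp
    rw [h, h3]; ring
  · rw [rowFun_zero_of_ne h, seriesPair_smul_right _ _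
      (u := fun t => cosRho S k t - cosN (modelIndex p k) t) (h1.sub h2),
      seriesPair_sub_right c h1 h2]
    field_simp
    ring

theorem exists_mem_ker {p : ℕ} {S : SpectralData} (hS : S ∈ classS p)
    (hAB : p + 1 ≤ A S + B S) {H : m →L[ℂ] m} (hH : IsHOperator p S π H) :
    ∃ a : m, a ≠ 0 ∧ H a = -a := by
  obtain ⟨c, hc0, hc⟩ := exists_ne_zero_seriesPair_cosRho hS hAB
  obtain ⟨R, hR⟩ := exists_norm_le_of_memlp (memlp_rhoHat hS)
  have hmem : Memℓp (fun ni : ℕ+ × Fin 2 => seriesPair c (rowFun p S ni.1 ni.2)) ∞ := by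
    refine memℓp_infty ⟨π * (trigConst R + π + 1) * ‖c‖, ?_⟩
    rintro _ ⟨ni, rfl⟩
    exact norm_seriesPair_le c (continuous_rowFun p S _ _)
      fun t ht => norm_rowFun_le hR ni.1 ni.2 ht
  let a : m := ⟨_, hmem⟩
  have ha : ∀ n i, a (n, i) = seriesPair c (rowFun p S n i) := fun n i => rfl
  have hpi : (π : ℂ) ≠ 0 := by exact_mod_cast pi_ne_zero
  refine ⟨a, fun h => hc0 ?_, ?_⟩
  · ext j
    have h1 : a (modelPos p j, 1) = 0 := by rw [h]; rfl
    rw [ha, rowFun_one, modelIndex_modelPos, seriesPair_cosN] at h1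
    refine (mul_eq_zero.1 h1).resolve_right ?_
    split_ifs <;> simp [hpi]
  · ext ⟨n, i⟩
    have hu := continuous_rowFun p S n i
    have hsum := (hH a n i).prod_fiberwise fun k => hasSum_fintype _
    -- The two columns of block `k` combine into `α_k ∫ f cos ρ_k t`, which vanishes either through
    -- `α_k = 0` or by the choice of `f`. Only the model term survives.
    have hterm : ∀ k, ∑ j : Fin 2, Hblock p S π n k i j * a (k, j) =
        -((model p).alpha k * pair (rowFun p S n i) (cosN (modelIndex p k))
          * seriesPair c (cosN (modelIndex p k))) := by
      intro k
      have h1 := seriesPair_rowFun p S c k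
      have h2 : S.alpha k * seriesPair c (cosRho S k) = 0 := by
        by_cases h : S.alpha k = 0
        · rw [h, zero_mul]
        · rw [hc k h, mul_zero]
      rw [← h1, rowFun_one] at h2
      rw [Fin.sum_univ_two, Hblock_eq_pair, Hblock_eq_pair, pair_colFun_zero,
        pair_colFun_one p S k hu, ha, ha, rowFun_one]
      linear_combination pair (rowFun p S n i) (cosRho S k) * h2
    simp only [hterm] at hsum
    -- Indices outside the range of `modelPos` have `α̃_k = 0`, so the sum runs over the frequencies
    -- `j`, each occurring once.
    have h3 := (modelPos_injective p).hasSum_iff (f := fun k =>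
      -((model p).alpha k * pair (rowFun p S n i) (cosN (modelIndex p k))
          * seriesPair c (cosN (modelIndex p k)))) (a := H a (n, i)) (fun k hk => by
      rw [model_alpha_eq_zero hk]; simp)
    have h4 := h3.2 hsum
    refine h4.unique ?_
    have h6 : ((fun k => -((model p).alpha k * pair (rowFun p S n i) (cosN (modelIndex p k))
        * seriesPair c (cosN (modelIndex p k)))) ∘ modelPos p) =
        fun j => -(c j * pair (rowFun p S n i) (cosN j)) := by
      funext j
      have h5 := model_alpha_modelPos p j
      simp only [Function.comp_apply, modelIndex_modelPos, seriesPair_cosN]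
      linear_combination (-(c j * pair (rowFun p S n i) (cosN j))) * h5
    rw [h6]
    exact (hasSum_seriesPair c hu).neg

end PolySL

end

theorem theorem3 (p : ℕ) (S : PolySL.SpectralData) (hS : S ∈ PolySL.classS p)
    (hAB : p + 1 ≤ PolySL.A S + PolySL.B S) :
    ∃ H : PolySL.m →L[ℂ] PolySL.m,
      PolySL.IsHOperator p S Real.pi H ∧ ¬ IsUnit (1 + H) := by
  obtain ⟨C, hC⟩ := PolySL.exists_row_sums_le hS
  obtain ⟨H, hH⟩ := PolySL.exists_clm_of_row_sums_le
    (h := fun ni kj : ℕ+ × Fin 2 => PolySL.Hblock p S Real.pi ni.1 kj.1 ni.2 kj.2) hC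
  have hop : PolySL.IsHOperator p S Real.pi H := fun f n i => hH f (n, i)
  refine ⟨H, hop, fun hu => ?_⟩
  obtain ⟨a, ha0, ha⟩ := PolySL.exists_mem_ker hS hAB hop
  obtain ⟨U, hU⟩ := hu
  have h1 : (U : PolySL.m →L[ℂ] PolySL.m) a = 0 := by
    rw [hU, add_apply, ha]
    exact add_neg_cancel a
  refine ha0 ?_
  have h2 : ((U⁻¹ : (PolySL.m →L[ℂ] PolySL.m)ˣ) : PolySL.m →L[ℂ] PolySL.m)
      ((U : PolySL.m →L[ℂ] PolySL.m) a) = a :=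
    congrArg (fun T : PolySL.m →L[ℂ] PolySL.m => T a) U.inv_mul
  rw [← h2, h1, map_zero]
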